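/- Let $n\ge 2$ and $m\ge 0$ be integers, $Y=(0,1)^n$, and let $\mathcal A,\mathcal B$ be nonempty compact metric spaces. Let $G=G(y,\alpha,\beta)\in\mathbb R^{n\times m}$, $b=b(x,y,\alpha,\beta)\in\mathbb R^n$ and $f=f(x,y,\alpha,\beta)\in\mathbb R$ (with $x,y\in\mathbb R^n$, $(\alpha,\beta)\in\mathcal A\times\mathcal B$) be bounded continuous functions that are $Y$-periodic in $y$ (i.e. invariant under $y\mapsto y+k$, $k\in\mathbb Z^n$), with $G,b$ Lipschitz continuous in $(x,y)$ uniformly in $(\alpha,\beta)$ and $f$ uniformly continuous in $(x,y)$ uniformly in $(\alpha,\beta)$. Put $A=\tfrac12 GG^{\mathrm T}$ and assume: (uniform ellipticity) there are $\zeta_1,\zeta_2>0$ with $\zeta_1|\xi|^2\le A(y,\alpha,\beta)\xi\cdot\xi\le\zeta_2|\xi|^2$ for all $y,\xi\in\mathbb R^n$, $(\alpha,\beta)\in\mathcal A\times\mathcal B$; (Cordes condition) there are $\lambda>0$ and $\delta\in(0,1)$ with $$|A|^2+\frac{|b|^2}{2\lambda}+\frac1{\lambda^2}\le\frac1{n+\delta}\Big(\mathrm{tr}(A)+\frac1\lambda\Big)^2\qquad\text{for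 all }(x,y,\alpha,\beta)\in\mathbb R^n\times\mathbb R^n\times\mathcal A\times\mathcal B,$$ where $|M|=\sqrt{M:M}$ and $M:N=\sum_{i,j}M_{ij}N_{ij}$. Let $H^2_{\mathrm{per}}(Y)$ be the closure in $H^2(Y)$, with respect to the $H^2$-norm, of the restrictions to $Y$ of smooth $Y$-periodic functions on $\mathbb R^n$. Fix $x,p\in\mathbb R^n$ and a symmetric matrix $R\in\mathbb R^{n\times n}$, and set $$g(y,\alpha,\beta)=A(y,\alpha,\beta):R+b(x,y,\alpha,\beta)\cdot p+f(x,y,\alpha,\beta).$$ Then for every $\sigma>0$ there is a unique periodic strong solution $v^\sigma$ of the cell $\sigma$-problem, i.e. a unique $v^\sigma\in H^2_{\mathrm{per}}(Y)$ with $$\inf_{\alpha\in\mathcal A}\sup_{\beta\in\mathcal B}\big\{-A(y,\alpha,\beta):\nabla^2v^\sigma(y)+\sigma v^\sigma(y)-g(y,\alpha,\beta)\big\}=0\qquad\text{for a.e. }y\in Y.$$ Moreover, there is a constant $C>0$, independent of $\sigma$, such that $|v^\sigma|_{H^2(Y)}:=\|\nabla^2v^\sigma\|_{L^2(Y)}\le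 C$ for all $\sigma>0$. -/

import Mathlib

open MeasureTheory Set
open scoped ContDiff Matrix NNReal

noncomputable section

namespace PeriodicHJBI

/- Points of `ℝⁿ` are functions `Fin n → ℝ`, with the Lebesgue measure `volume`. Euclidean lengths and
inner products are always written out by `⬝ᵥ`; the (equivalent) sup norm of `Fin n → ℝ` enters only
in qualitative notions (continuity, boundedness, Lipschitz continuity, smoothness). -/

/-- The open unit cell `Y = (0,1)ⁿ`. -/
def unitCell (n : ℕ) : Set (Fin n → ℝ) := {y | ∀ i, y i ∈ Ioo (0 : ℝ) 1}

/-- Lebesgue measure on `Y`. -/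
abbrev cellMeasure (n : ℕ) : Measure (Fin n → ℝ) := volume.restrict (unitCell n)

/-- The real Hilbert space `L²(Y)` (functions modulo a.e. equality). -/
abbrev L2Cell (n : ℕ) : Type := Lp ℝ 2 (cellMeasure n)

/-- `Y`-periodicity: invariance under translation by integer vectors. -/
def IsCellPeriodic {n : ℕ} {E : Type*} (φ : (Fin n → ℝ) → E) : Prop :=
  ∀ (y : Fin n → ℝ) (k : Fin n → ℤ), φ (y + fun i => (k i : ℝ)) = φ y

/-- `w ∈ L²(Y)` is the weak partial derivative `∂ᵢ u` in `Y` of `u ∈ L²(Y)`. -/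
def IsWeakPartial {n : ℕ} (i : Fin n) (u w : L2Cell n) : Prop :=
  ∀ φ : (Fin n → ℝ) → ℝ, ContDiff ℝ ∞ φ → HasCompactSupport φ → tsupport φ ⊆ unitCell n →
    ∫ y in unitCell n, u y * fderiv ℝ φ y (Pi.single i 1) = -∫ y in unitCell n, w y * φ y

open Classical in
/-- The weak partial derivative `∂ᵢ u ∈ L²(Y)` of `u ∈ L²(Y)` if there is one (it is then unique),
and `0` otherwise. -/
def weakPartial {n : ℕ} (i : Fin n) (u : L2Cell n) : L2Cell n :=
  if h : ∃ w, IsWeakPartial i u w then h.choose else 0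

/-- `u ∈ H²(Y)`: the first and second weak partial derivatives exist in `L²(Y)`. -/
def MemH2 {n : ℕ} (u : L2Cell n) : Prop :=
  (∀ i, ∃ w, IsWeakPartial i u w) ∧ ∀ i j, ∃ w, IsWeakPartial j (weakPartial i u) w

/-- The seminorm `|u|_{H²(Y)} = ‖∇²u‖_{L²(Y)}`. -/
def h2Seminorm {n : ℕ} (u : L2Cell n) : ℝ :=
  √(∑ i, ∑ j, ‖weakPartial j (weakPartial i u)‖ ^ 2)

/-- The norm `‖u‖_{H²(Y)}`. -/
def h2Norm {n : ℕ} (u : L2Cell n) : ℝ :=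
  √(‖u‖ ^ 2 + ∑ i, ‖weakPartial i u‖ ^ 2 + h2Seminorm u ^ 2)

/-- `φ ∈ C^∞_per(Y)`: `φ` is the restriction to `Y` of a smooth `Y`-periodic function on `ℝⁿ`. -/
def MemSmoothPer {n : ℕ} (φ : L2Cell n) : Prop :=
  ∃ Φ : (Fin n → ℝ) → ℝ, ContDiff ℝ ∞ Φ ∧ IsCellPeriodic Φ ∧ φ =ᵐ[cellMeasure n] Φ

/-- `u ∈ H²_per(Y)`: the closure of `C^∞_per(Y)` in `H²(Y)` with respect to the `H²`-norm. -/
def MemH2Per {n : ℕ} (u : L2Cell n) : Prop :=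
  MemH2 u ∧ ∀ ε > 0, ∃ φ : L2Cell n, MemSmoothPer φ ∧ h2Norm (u - φ) < ε

/-- The Hessian matrix `∇²u(y)` of weak second derivatives. -/
def weakHessian {n : ℕ} (u : L2Cell n) (y : Fin n → ℝ) : Matrix (Fin n) (Fin n) ℝ :=
  Matrix.of fun i j => (weakPartial j (weakPartial i u) : L2Cell n) y

/-- The Frobenius product `M : N = ∑ᵢⱼ Mᵢⱼ Nᵢⱼ`. -/
def frob {n : ℕ} (M N : Matrix (Fin n) (Fin n) ℝ) : ℝ := ∑ i, ∑ j, M i j * N i j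

/-- The diffusion matrix `A = ½ G Gᵀ`. -/
def diffusion {n m : ℕ} {𝒜 ℬ : Type*} (G : (Fin n → ℝ) → 𝒜 → ℬ → Matrix (Fin n) (Fin m) ℝ)
    (y : Fin n → ℝ) (α : 𝒜) (β : ℬ) : Matrix (Fin n) (Fin n) ℝ :=
  (1 / 2 : ℝ) • (G y α β * (G y α β)ᵀ)

/-- The assumptions on the coefficients `G = G(y,α,β)`, `b = b(x,y,α,β)`, `f = f(x,y,α,β)`, where
`A = ½ G Gᵀ`. -/
structure CoefficientAssumptions {n m : ℕ} {𝒜 ℬ : Type*} [MetricSpace 𝒜] [MetricSpace ℬ]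
    (G : (Fin n → ℝ) → 𝒜 → ℬ → Matrix (Fin n) (Fin m) ℝ)
    (b : (Fin n → ℝ) → (Fin n → ℝ) → 𝒜 → ℬ → (Fin n → ℝ))
    (f : (Fin n → ℝ) → (Fin n → ℝ) → 𝒜 → ℬ → ℝ) : Prop where
  continuous_G : Continuous fun z : (Fin n → ℝ) × 𝒜 × ℬ => G z.1 z.2.1 z.2.2
  continuous_b : Continuous fun z : (Fin n → ℝ) × (Fin n → ℝ) × 𝒜 × ℬ =>
    b z.1 z.2.1 z.2.2.1 z.2.2.2
  continuous_f : Continuous fun z : (Fin n → ℝ) × (Fin n → ℝ) × 𝒜 × ℬ =>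
    f z.1 z.2.1 z.2.2.1 z.2.2.2
  bounded_G : ∃ K : ℝ, ∀ y α β i j, |G y α β i j| ≤ K
  bounded_b : ∃ K : ℝ, ∀ x y α β i, |b x y α β i| ≤ K
  bounded_f : ∃ K : ℝ, ∀ x y α β, |f x y α β| ≤ K
  /-- `G` is Lipschitz in `y`, uniformly in `(α,β)`. -/
  lipschitz_G : ∃ K : ℝ≥0, ∀ α β i j, LipschitzWith K fun y => G y α β i j
  /-- `b` is Lipschitz in `(x,y)`, uniformly in `(α,β)`. -/
  lipschitz_b : ∃ K : ℝ≥0, ∀ α β,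
    LipschitzWith K fun z : (Fin n → ℝ) × (Fin n → ℝ) => b z.1 z.2 α β
  /-- `f` is uniformly continuous in `(x,y)`, uniformly in `(α,β)`. -/
  uniformContinuous_f : ∀ ε > 0, ∃ η > 0, ∀ α β (z z' : (Fin n → ℝ) × (Fin n → ℝ)),
    dist z z' < η → |f z.1 z.2 α β - f z'.1 z'.2 α β| < ε
  periodic_G : ∀ α β, IsCellPeriodic fun y => G y α β
  periodic_b : ∀ x α β, IsCellPeriodic fun y => b x y α β
  periodic_f : ∀ x α β, IsCellPeriodic fun y => f x y α β
  /-- Uniform ellipticity. -/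
  elliptic : ∃ ζ₁ ζ₂ : ℝ, 0 < ζ₁ ∧ 0 < ζ₂ ∧ ∀ y α β (ξ : Fin n → ℝ),
    ζ₁ * (ξ ⬝ᵥ ξ) ≤ (diffusion G y α β *ᵥ ξ) ⬝ᵥ ξ ∧
      (diffusion G y α β *ᵥ ξ) ⬝ᵥ ξ ≤ ζ₂ * (ξ ⬝ᵥ ξ)
  /-- The Cordes condition. -/
  cordes : ∃ lam δ : ℝ, 0 < lam ∧ 0 < δ ∧ δ < 1 ∧ ∀ x y α β,
    frob (diffusion G y α β) (diffusion G y α β) + (b x y α β ⬝ᵥ b x y α β) / (2 * lam)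
        + 1 / lam ^ 2
      ≤ 1 / (n + δ) * ((diffusion G y α β).trace + 1 / lam) ^ 2

/-- The source `g_{x,p,R}(y,α,β) = A(y,α,β) : R + b(x,y,α,β) · p + f(x,y,α,β)`. -/
def cellSource {n m : ℕ} {𝒜 ℬ : Type*} (G : (Fin n → ℝ) → 𝒜 → ℬ → Matrix (Fin n) (Fin m) ℝ)
    (b : (Fin n → ℝ) → (Fin n → ℝ) → 𝒜 → ℬ → (Fin n → ℝ))
    (f : (Fin n → ℝ) → (Fin n → ℝ) → 𝒜 → ℬ → ℝ)
    (x p : Fin n → ℝ) (R : Matrix (Fin n) (Fin n) ℝ) (y : Fin n → ℝ) (α : 𝒜) (β : ℬ) : ℝ :=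
  frob (diffusion G y α β) R + b x y α β ⬝ᵥ p + f x y α β

/-- `v ∈ H²_per(Y)` is a periodic strong solution of the cell `σ`-problem
`inf_α sup_β {-A : ∇²v + σ v - g_{x,p,R}} = 0`, i.e. the equation holds a.e. in `Y`. (For compact
`𝒜`, `ℬ` and continuous coefficients, the real infimum and supremum below are over bounded sets.) -/
def IsPeriodicStrongSolution {n m : ℕ} {𝒜 ℬ : Type*}
    (G : (Fin n → ℝ) → 𝒜 → ℬ → Matrix (Fin n) (Fin m) ℝ)
    (b : (Fin n → ℝ) → (Fin n → ℝ) → 𝒜 → ℬ → (Fin n → ℝ))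
    (f : (Fin n → ℝ) → (Fin n → ℝ) → 𝒜 → ℬ → ℝ)
    (x p : Fin n → ℝ) (R : Matrix (Fin n) (Fin n) ℝ) (σ : ℝ) (v : L2Cell n) : Prop :=
  MemH2Per v ∧ ∀ᵐ y ∂cellMeasure n,
    ⨅ α : 𝒜, ⨆ β : ℬ, (-frob (diffusion G y α β) (weakHessian v y) + σ * v y
      - cellSource G b f x p R y α β) = 0

end PeriodicHJBI

end

noncomputable section

namespace PeriodicHJBI

open Filter Topology

variable {n : ℕ}

/-! The proof is Campanato's nearness method under the Cordes condition. Put `t = 1/lam`, `μ = lam *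
σ` and `γ = (tr A + t)/(|A|² + t²) > 0`. Multiplying the expression inside the inf-sup by `γ` does
not change whether the inf-sup vanishes, because `γ` is continuous and positive on a compact
parameter space. By Cauchy–Schwarz and the Cordes condition, increments of the renormalized operator
`F` differ from those of `μ - Δ` by at most `√(1 - δ) * √(|∇²w|² + (μ w)²)` pointwise, where `w` is
the difference of the two functions (`abs_cordes_le`, `nearLaplace_cordesHamiltonian`).

Periodicity removes all boundary terms, so on `H²_per` one has `‖(μ - Δ)w‖² = μ²‖w‖² + 2μ‖∇w‖² +
‖∇²w‖²` (`MemH2Per.norm_sq_shiftedLaplace`). Hence the pointwise error has L² norm at most `√(1 - δ)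
‖(μ - Δ)w‖`. The same identity makes `μ - Δ` injective with closed range; trigonometric
eigenfunctions make the range dense (`exists_shiftedLaplace_eq`).

Thus `g ↦ g - F((μ - Δ)⁻¹ g)` is a contraction of `L²(Y)`, and its fixed points are exactly the
images under `μ - Δ` of the solutions. Comparing a solution with `0` bounds `‖(μ - Δ)v‖`, hence
`‖∇²v‖`, by `‖F(0)‖/(1 - √(1 - δ))`; since `F(0)` contains no `σ`, the bound is uniform. -/

/-! ### The unit cell and its measure -/

theorem unitCell_eq_pi (n : ℕ) : unitCell n = Set.pi univ fun _ => Ioo (0 : ℝ) 1 := by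
  ext y; simp [unitCell]

theorem isOpen_unitCell (n : ℕ) : IsOpen (unitCell n) := by
  rw [unitCell_eq_pi]
  exact isOpen_set_pi finite_univ fun _ _ => isOpen_Ioo

theorem measurableSet_unitCell (n : ℕ) : MeasurableSet (unitCell n) :=
  (isOpen_unitCell n).measurableSet

theorem unitCell_ae_eq_Icc (n : ℕ) :
    unitCell n =ᵐ[volume] Icc (0 : Fin n → ℝ) 1 := by
  rw [unitCell_eq_pi]
  exact Measure.univ_pi_Ioo_ae_eq_Icc

theorem unitCell_subset_Icc (n : ℕ) : unitCell n ⊆ Icc (0 : Fin n → ℝ) 1 := fun _ hy =>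
  ⟨fun i => (hy i).1.le, fun i => (hy i).2.le⟩

instance isFiniteMeasure_cellMeasure (n : ℕ) : IsFiniteMeasure (cellMeasure n) := by
  refine ⟨?_⟩
  rw [cellMeasure, Measure.restrict_apply_univ, measure_congr (unitCell_ae_eq_Icc n)]
  exact isCompact_Icc.measure_lt_top

theorem memLp_of_continuous {Φ : (Fin n → ℝ) → ℝ} (hΦ : Continuous Φ) :
    MemLp Φ 2 (cellMeasure n) := by
  obtain ⟨C, hC⟩ := (isCompact_Icc (a := (0 : Fin n → ℝ)) (b := 1)).exists_bound_of_continuousOn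
    hΦ.continuousOn
  refine MemLp.of_bound hΦ.aestronglyMeasurable C ?_
  filter_upwards [ae_restrict_mem (measurableSet_unitCell n)] with y hy
  exact hC y (unitCell_subset_Icc n hy)

theorem integrable_of_continuous {Φ : (Fin n → ℝ) → ℝ} (hΦ : Continuous Φ) :
    Integrable Φ (cellMeasure n) :=
  (memLp_of_continuous hΦ).integrable one_le_two

/-! ### Calculus of smooth periodic functions -/

/-- The classical partial derivative in the `i`-th coordinate direction. -/
def pderiv (i : Fin n) (Φ : (Fin n → ℝ) → ℝ) (y : Fin n → ℝ) : ℝ :=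
  fderiv ℝ Φ y (Pi.single i 1)

theorem contDiff_pderiv {Φ : (Fin n → ℝ) → ℝ} (hΦ : ContDiff ℝ ∞ Φ) (i : Fin n) :
    ContDiff ℝ ∞ (pderiv i Φ) :=
  (hΦ.fderiv_right (m := ∞) (by simp)).clm_apply contDiff_const

theorem pderiv_add {Φ Ψ : (Fin n → ℝ) → ℝ} (hΦ : ContDiff ℝ ∞ Φ) (hΨ : ContDiff ℝ ∞ Ψ)
    (i : Fin n) : pderiv i (Φ + Ψ) = pderiv i Φ + pderiv i Ψ := by
  ext y
  simp [pderiv, fderiv_add (hΦ.differentiable (by simp) y) (hΨ.differentiable (by simp) y)]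

theorem pderiv_smul {Φ : (Fin n → ℝ) → ℝ} (hΦ : ContDiff ℝ ∞ Φ) (c : ℝ)
    (i : Fin n) : pderiv i (c • Φ) = c • pderiv i Φ := by
  ext y
  simp [pderiv, fderiv_const_smul (hΦ.differentiable (by simp) y)]

theorem pderiv_mul {Φ Ψ : (Fin n → ℝ) → ℝ} (hΦ : ContDiff ℝ ∞ Φ) (hΨ : ContDiff ℝ ∞ Ψ)
    (i : Fin n) : pderiv i (Φ * Ψ) = pderiv i Φ * Ψ + Φ * pderiv i Ψ := by
  ext y
  simp [pderiv, fderiv_mul (hΦ.differentiable (by simp) y) (hΨ.differentiable (by simp) y)]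
  ring

theorem pderiv_comm {Φ : (Fin n → ℝ) → ℝ} (hΦ : ContDiff ℝ ∞ Φ) (i j : Fin n) :
    pderiv i (pderiv j Φ) = pderiv j (pderiv i Φ) := by
  have key : ∀ (k l : Fin n) (y : Fin n → ℝ), pderiv k (pderiv l Φ) y
      = fderiv ℝ (fderiv ℝ Φ) y (Pi.single k 1) (Pi.single l 1) := by
    intro k l y
    have hd : DifferentiableAt ℝ (fderiv ℝ Φ) y :=
      (hΦ.fderiv_right (m := ∞) (by simp)).differentiable (by simp) y
    change fderiv ℝ (fun z => fderiv ℝ Φ z (Pi.single l 1)) y (Pi.single k 1) = _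
    rw [fderiv_clm_apply hd (differentiableAt_const _)]
    simp
  ext y
  rw [key, key]
  exact ((contDiff_infty.1 hΦ 2).contDiffAt.isSymmSndFDerivAt (x := y)
    (by rw [minSmoothness_of_isRCLikeNormedField]; rfl)).eq _ _

/-- Smooth `Y`-periodic functions on `ℝⁿ`. -/
structure SmoothPer (Φ : (Fin n → ℝ) → ℝ) : Prop where
  smooth : ContDiff ℝ ∞ Φ
  per : IsCellPeriodic Φ

namespace SmoothPer

variable {Φ Ψ : (Fin n → ℝ) → ℝ}

theorem continuous (h : SmoothPer Φ) : Continuous Φ := h.smooth.continuous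

theorem pderiv (h : SmoothPer Φ) (i : Fin n) : SmoothPer (pderiv i Φ) := by
  refine ⟨contDiff_pderiv h.smooth i, fun y k => ?_⟩
  have : Φ = fun z => Φ (z + fun i => (k i : ℝ)) := funext fun z => (h.per z k).symm
  simp only [PeriodicHJBI.pderiv]
  conv_rhs => rw [this]
  rw [fderiv_comp_add_right]

theorem add (h : SmoothPer Φ) (h' : SmoothPer Ψ) : SmoothPer (Φ + Ψ) :=
  ⟨h.smooth.add h'.smooth, fun y k => by simp [h.per y k, h'.per y k]⟩

theorem smul (h : SmoothPer Φ) (c : ℝ) : SmoothPer (c • Φ) :=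
  ⟨h.smooth.const_smul c, fun y k => by simp [h.per y k]⟩

theorem mul (h : SmoothPer Φ) (h' : SmoothPer Ψ) : SmoothPer (Φ * Ψ) :=
  ⟨h.smooth.mul h'.smooth, fun y k => by simp [h.per y k, h'.per y k]⟩

theorem zero : SmoothPer (0 : (Fin n → ℝ) → ℝ) :=
  ⟨contDiff_const, fun _ _ => rfl⟩

/-- The divergence theorem on the closed cube, for the field whose only nonzero component is `Φ` in
direction `i`: the two opposite faces cancel by periodicity. -/
theorem integral_pderiv (h : SmoothPer Φ) (i : Fin n) :
    ∫ y in unitCell n, PeriodicHJBI.pderiv i Φ y = 0 := by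
  rw [setIntegral_congr_set (unitCell_ae_eq_Icc n)]
  obtain _ | n := n
  · exact i.elim0
  have hd := h.smooth.differentiable (by simp)
  have hc := (h.pderiv i).continuous
  have hsum : ∀ y : Fin (n + 1) → ℝ, ∑ j, (if j = i then fderiv ℝ Φ y else 0) (Pi.single j 1)
      = PeriodicHJBI.pderiv i Φ y := by
    intro y
    rw [Finset.sum_eq_single i]
    · simp [PeriodicHJBI.pderiv]
    · intro j _ hj; simp [hj]
    · simp
  have := integral_divergence_of_hasFDerivAt_off_countable' (E := ℝ) (0 : Fin (n + 1) → ℝ) 1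
    (fun _ => zero_le_one) (fun j => if j = i then Φ else 0)
    (fun j y => if j = i then fderiv ℝ Φ y else 0) ∅ countable_empty
    (fun j => by
      split_ifs
      · exact h.continuous.continuousOn
      · exact continuousOn_const)
    (fun y _ j => by
      split_ifs
      · exact (hd y).hasFDerivAt
      · exact hasFDerivAt_const _ _)
    (by
      simp only [hsum]
      exact hc.continuousOn.integrableOn_compact isCompact_Icc)
  simp only [hsum] at this
  rw [this]
  refine Finset.sum_eq_zero fun j _ => ?_
  rw [sub_eq_zero]
  congr 1
  ext y
  split_ifs
  -- Translation by the `j`-th unit vector carries the face at `0` to the face at `1`.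
  · have h1 := h.per (j.insertNth 0 y) (Pi.single j 1)
    have h2 : (j.insertNth (0 : ℝ) y + fun l => (((Pi.single j 1 : Fin (n + 1) → ℤ) l : ℤ) : ℝ))
        = j.insertNth (1 : ℝ) y := by
      ext l
      refine Fin.succAboveCases j ?_ (fun l => ?_) l
      · simp
      · simp [Pi.single_apply, Fin.succAbove_ne]
    rw [h2] at h1
    simpa using h1
  · rfl

theorem integral_pderiv_mul (h : SmoothPer Φ) (h' : SmoothPer Ψ) (i : Fin n) :
    ∫ y in unitCell n, PeriodicHJBI.pderiv i Φ y * Ψ y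
      = -∫ y in unitCell n, Φ y * PeriodicHJBI.pderiv i Ψ y := by
  have h0 := (h.mul h').integral_pderiv i
  rw [pderiv_mul h.smooth h'.smooth] at h0
  simp only [Pi.add_apply, Pi.mul_apply] at h0
  rw [integral_add] at h0
  · linarith
  · exact integrable_of_continuous ((h.pderiv i).continuous.mul h'.continuous)
  · exact integrable_of_continuous (h.continuous.mul (h'.pderiv i).continuous)

end SmoothPer

/-! ### Weak derivatives in L² -/

/-- The class in `L²(Y)` of a continuous function. -/
def contL2 (Φ : (Fin n → ℝ) → ℝ) (hΦ : Continuous Φ) : L2Cell n :=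
  (memLp_of_continuous hΦ).toLp Φ

theorem coeFn_contL2 {Φ : (Fin n → ℝ) → ℝ} (hΦ : Continuous Φ) :
    contL2 Φ hΦ =ᵐ[cellMeasure n] Φ :=
  MemLp.coeFn_toLp _

theorem inner_contL2 {Φ : (Fin n → ℝ) → ℝ} (hΦ : Continuous Φ) (u : L2Cell n) :
    inner ℝ (contL2 Φ hΦ) u = ∫ y in unitCell n, u y * Φ y := by
  rw [L2.inner_def]
  refine integral_congr_ae ?_
  filter_upwards [coeFn_contL2 hΦ] with y hy
  simp [hy]

theorem inner_contL2_contL2 {Φ Ψ : (Fin n → ℝ) → ℝ} (hΦ : Continuous Φ) (hΨ : Continuous Ψ) :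
    inner ℝ (contL2 Φ hΦ) (contL2 Ψ hΨ) = ∫ y in unitCell n, Φ y * Ψ y := by
  rw [inner_contL2]
  refine integral_congr_ae ?_
  filter_upwards [coeFn_contL2 hΨ] with y hy
  rw [hy, mul_comm]

/-- In this form, linearity and closedness of weak differentiation follow from those of the inner
product. -/
theorem isWeakPartial_iff_inner {i : Fin n} {u w : L2Cell n} :
    IsWeakPartial i u w ↔ ∀ (φ : (Fin n → ℝ) → ℝ) (hφ : ContDiff ℝ ∞ φ), HasCompactSupport φ →
      tsupport φ ⊆ unitCell n →
      inner ℝ (contL2 (pderiv i φ) (contDiff_pderiv hφ i).continuous) u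
        = -inner ℝ (contL2 φ hφ.continuous) w := by
  simp only [inner_contL2]
  rfl

/-- The fundamental lemma of the calculus of variations on the open cell. It allows the chosen
`weakPartial` to be computed from any witness. -/
theorem IsWeakPartial.unique {i : Fin n} {u w w' : L2Cell n} (h : IsWeakPartial i u w)
    (h' : IsWeakPartial i u w') : w = w' := by
  rw [isWeakPartial_iff_inner] at h h'
  rw [← sub_eq_zero]
  have hint : Integrable (w - w' : L2Cell n) (cellMeasure n) :=
    (Lp.memLp _).integrable one_le_two
  have := (isOpen_unitCell n).ae_eq_zero_of_integral_contDiff_smul_eq_zero (μ := volume)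
    (f := (w - w' : L2Cell n)) (IntegrableOn.locallyIntegrableOn hint) (fun g hg hc ht => by
      have h1 : inner ℝ (contL2 g hg.continuous) (w - w') = 0 := by
        rw [inner_sub_right]
        linarith [h g hg hc ht, h' g hg hc ht]
      rw [inner_contL2] at h1
      rw [← setIntegral_eq_integral_of_forall_compl_eq_zero (s := unitCell n), ← h1]
      · simp [mul_comm]
      · intro x hx
        rw [image_eq_zero_of_notMem_tsupport fun hx' => hx (ht hx'), zero_smul])
  refine Lp.eq_zero_iff_ae_eq_zero.2 ?_
  exact (ae_restrict_iff' (measurableSet_unitCell n)).2 this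

theorem IsWeakPartial.weakPartial_eq {i : Fin n} {u w : L2Cell n} (h : IsWeakPartial i u w) :
    weakPartial i u = w := by
  have hex : ∃ w, IsWeakPartial i u w := ⟨w, h⟩
  rw [weakPartial, dif_pos hex]
  exact hex.choose_spec.unique h

theorem isWeakPartial_weakPartial {i : Fin n} {u : L2Cell n} (h : ∃ w, IsWeakPartial i u w) :
    IsWeakPartial i u (weakPartial i u) := by
  rw [weakPartial, dif_pos h]
  exact h.choose_spec

theorem IsWeakPartial.sub {i : Fin n} {u w u' w' : L2Cell n} (h : IsWeakPartial i u w)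
    (h' : IsWeakPartial i u' w') : IsWeakPartial i (u - u') (w - w') := by
  rw [isWeakPartial_iff_inner] at *
  intro φ hφ hc ht
  rw [inner_sub_right, inner_sub_right, h φ hφ hc ht, h' φ hφ hc ht]
  ring

theorem IsWeakPartial.of_tendsto {i : Fin n} {u w : ℕ → L2Cell n} {u₀ w₀ : L2Cell n}
    (h : ∀ k, IsWeakPartial i (u k) (w k)) (hu : Tendsto u atTop (𝓝 u₀))
    (hw : Tendsto w atTop (𝓝 w₀)) : IsWeakPartial i u₀ w₀ := by
  rw [isWeakPartial_iff_inner]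
  intro φ hφ hc ht
  refine tendsto_nhds_unique (tendsto_const_nhds.inner hu) ?_
  simp only [isWeakPartial_iff_inner.1 (h _) φ hφ hc ht]
  exact (tendsto_const_nhds.inner hw).neg

theorem MemH2.isWeakPartial {u : L2Cell n} (h : MemH2 u) (i : Fin n) :
    IsWeakPartial i u (weakPartial i u) :=
  isWeakPartial_weakPartial (h.1 i)

theorem MemH2.isWeakPartial₂ {u : L2Cell n} (h : MemH2 u) (i j : Fin n) :
    IsWeakPartial j (weakPartial i u) (weakPartial j (weakPartial i u)) :=
  isWeakPartial_weakPartial (h.2 i j)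

theorem memH2_of_isWeakPartial {u : L2Cell n} {w : Fin n → L2Cell n}
    {H : Fin n → Fin n → L2Cell n} (hw : ∀ i, IsWeakPartial i u (w i))
    (hH : ∀ i j, IsWeakPartial j (w i) (H i j)) : MemH2 u :=
  ⟨fun i => ⟨_, hw i⟩, fun i j => ⟨H i j, by rw [(hw i).weakPartial_eq]; exact hH i j⟩⟩

theorem MemH2.weakPartial_sub {u v : L2Cell n} (hu : MemH2 u) (hv : MemH2 v) (i : Fin n) :
    weakPartial i (u - v) = weakPartial i u - weakPartial i v :=
  ((hu.isWeakPartial i).sub (hv.isWeakPartial i)).weakPartial_eq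

theorem MemH2.weakPartial₂_sub {u v : L2Cell n} (hu : MemH2 u) (hv : MemH2 v) (i j : Fin n) :
    weakPartial j (weakPartial i (u - v))
      = weakPartial j (weakPartial i u) - weakPartial j (weakPartial i v) := by
  rw [hu.weakPartial_sub hv]
  exact ((hu.isWeakPartial₂ i j).sub (hv.isWeakPartial₂ i j)).weakPartial_eq

/-! ### The H² norm and the periodic space -/

theorem h2Seminorm_sq (u : L2Cell n) :
    h2Seminorm u ^ 2 = ∑ i, ∑ j, ‖weakPartial j (weakPartial i u)‖ ^ 2 :=
  Real.sq_sqrt (by positivity)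

theorem h2Norm_sq (u : L2Cell n) :
    h2Norm u ^ 2 = ‖u‖ ^ 2 + ∑ i, ‖weakPartial i u‖ ^ 2
      + ∑ i, ∑ j, ‖weakPartial j (weakPartial i u)‖ ^ 2 := by
  rw [h2Norm, Real.sq_sqrt (by positivity), h2Seminorm_sq]

theorem h2Norm_nonneg (u : L2Cell n) : 0 ≤ h2Norm u := Real.sqrt_nonneg _

theorem norm_le_h2Norm (u : L2Cell n) : ‖u‖ ≤ h2Norm u := by
  refine abs_le_of_sq_le_sq' ?_ (h2Norm_nonneg u) |>.2
  rw [h2Norm_sq]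
  have : 0 ≤ ∑ i, ‖weakPartial i u‖ ^ 2
      + ∑ i, ∑ j, ‖weakPartial j (weakPartial i u)‖ ^ 2 := by positivity
  linarith

theorem norm_weakPartial_le_h2Norm (u : L2Cell n) (i : Fin n) : ‖weakPartial i u‖ ≤ h2Norm u := by
  refine abs_le_of_sq_le_sq' ?_ (h2Norm_nonneg u) |>.2
  rw [h2Norm_sq]
  have h1 : 0 ≤ ∑ i, ∑ j, ‖weakPartial j (weakPartial i u)‖ ^ 2 := by positivity
  have h2 : ‖weakPartial i u‖ ^ 2 ≤ ∑ i, ‖weakPartial i u‖ ^ 2 :=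
    Finset.single_le_sum (f := fun i => ‖weakPartial i u‖ ^ 2) (fun _ _ => by positivity)
      (Finset.mem_univ i)
  linarith [sq_nonneg ‖u‖]

theorem norm_weakPartial₂_le_h2Norm (u : L2Cell n) (i j : Fin n) :
    ‖weakPartial j (weakPartial i u)‖ ≤ h2Norm u := by
  refine abs_le_of_sq_le_sq' ?_ (h2Norm_nonneg u) |>.2
  rw [h2Norm_sq]
  have h1 : ‖weakPartial j (weakPartial i u)‖ ^ 2 ≤ ∑ j, ‖weakPartial j (weakPartial i u)‖ ^ 2 :=
    Finset.single_le_sum (f := fun j => ‖weakPartial j (weakPartial i u)‖ ^ 2)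
      (fun _ _ => by positivity) (Finset.mem_univ j)
  have h2 : ∑ j, ‖weakPartial j (weakPartial i u)‖ ^ 2
      ≤ ∑ i, ∑ j, ‖weakPartial j (weakPartial i u)‖ ^ 2 :=
    Finset.single_le_sum (f := fun i => ∑ j, ‖weakPartial j (weakPartial i u)‖ ^ 2)
      (fun _ _ => by positivity) (Finset.mem_univ i)
  have h3 : 0 ≤ ∑ i, ‖weakPartial i u‖ ^ 2 := by positivity
  linarith [sq_nonneg ‖u‖]

/-- The space `C^∞_per(Y)` of smooth `Y`-periodic functions. -/
def smoothPer (n : ℕ) : Submodule ℝ ((Fin n → ℝ) → ℝ) where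
  carrier := {Φ | SmoothPer Φ}
  add_mem' h h' := h.add h'
  zero_mem' := SmoothPer.zero
  smul_mem' c _ h := h.smul c

/-- The inclusion of `C^∞_per(Y)` into `L²(Y)`. -/
def toL2 : smoothPer n →ₗ[ℝ] L2Cell n where
  toFun φ := contL2 φ.1 φ.2.continuous
  map_add' _ _ := rfl
  map_smul' _ _ := rfl

/-- The partial derivative on `C^∞_per(Y)`. -/
def partialPer (i : Fin n) : smoothPer n →ₗ[ℝ] smoothPer n where
  toFun φ := ⟨pderiv i φ.1, φ.2.pderiv i⟩
  map_add' φ ψ := Subtype.ext (pderiv_add φ.2.smooth ψ.2.smooth i)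
  map_smul' c φ := Subtype.ext (pderiv_smul φ.2.smooth c i)

theorem partialPer_comm (i j : Fin n) (φ : smoothPer n) :
    partialPer i (partialPer j φ) = partialPer j (partialPer i φ) :=
  Subtype.ext (pderiv_comm φ.2.smooth i j)

theorem inner_partialPer_left (i : Fin n) (φ ψ : smoothPer n) :
    inner ℝ (toL2 (partialPer i φ)) (toL2 ψ) = -inner ℝ (toL2 φ) (toL2 (partialPer i ψ)) := by
  have := φ.2.integral_pderiv_mul ψ.2 i
  rw [← inner_contL2_contL2 (φ.2.pderiv i).continuous ψ.2.continuous,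
    ← inner_contL2_contL2 φ.2.continuous (ψ.2.pderiv i).continuous] at this
  exact this

/-- Test functions vanish outside the cell, so both integrals may be taken over all of `ℝⁿ`, where
integration by parts has no boundary term. -/
theorem isWeakPartial_toL2 (i : Fin n) (φ : smoothPer n) :
    IsWeakPartial i (toL2 φ) (toL2 (partialPer i φ)) := by
  rw [isWeakPartial_iff_inner]
  intro ψ hψ hc ht
  have hcont : Continuous (fun y => fderiv ℝ ψ y (Pi.single i 1)) :=
    (contDiff_pderiv hψ i).continuous
  have hφ := φ.2.continuous
  have hφ' : Continuous (fun y => fderiv ℝ φ.1 y (Pi.single i 1)) := (φ.2.pderiv i).continuous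
  have hc' : HasCompactSupport fun y => fderiv ℝ ψ y (Pi.single i 1) :=
    hc.fderiv_apply (𝕜 := ℝ) _
  have hz : ∀ x ∉ unitCell n, ψ x = 0 := fun x hx =>
    image_eq_zero_of_notMem_tsupport fun hx' => hx (ht hx')
  have hz' : ∀ x ∉ unitCell n, fderiv ℝ ψ x = 0 := fun x hx =>
    image_eq_zero_of_notMem_tsupport fun hx' => hx (ht (tsupport_fderiv_subset ℝ hx'))
  have key := integral_mul_fderiv_eq_neg_fderiv_mul_of_integrable (μ := volume)
    (f := φ.1) (g := ψ) (v := Pi.single i (1 : ℝ))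
    ((hφ'.mul hψ.continuous).integrable_of_hasCompactSupport hc.mul_left)
    ((hφ.mul hcont).integrable_of_hasCompactSupport hc'.mul_left)
    ((hφ.mul hψ.continuous).integrable_of_hasCompactSupport hc.mul_left)
    (fun x _ => φ.2.smooth.differentiable (by simp) x)
    (fun x _ => hψ.differentiable (by simp) x)
  change inner ℝ (contL2 _ _) (contL2 φ.1 φ.2.continuous)
    = -inner ℝ (contL2 _ _) (contL2 _ (φ.2.pderiv i).continuous)
  rw [inner_contL2_contL2, inner_contL2_contL2,
    setIntegral_eq_integral_of_forall_compl_eq_zero,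
    setIntegral_eq_integral_of_forall_compl_eq_zero]
  · simp only [pderiv, mul_comm]
    simpa only [mul_comm] using key
  · intro x hx
    rw [hz x hx, zero_mul]
  · intro x hx
    rw [pderiv, hz' x hx]
    simp

theorem weakPartial_toL2 (i : Fin n) (φ : smoothPer n) :
    weakPartial i (toL2 φ) = toL2 (partialPer i φ) :=
  (isWeakPartial_toL2 i φ).weakPartial_eq

theorem memH2_toL2 (φ : smoothPer n) : MemH2 (toL2 φ) :=
  memH2_of_isWeakPartial (fun i => isWeakPartial_toL2 i φ)
    fun i j => isWeakPartial_toL2 j (partialPer i φ)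

theorem memSmoothPer_iff {u : L2Cell n} : MemSmoothPer u ↔ ∃ φ : smoothPer n, toL2 φ = u := by
  constructor
  · rintro ⟨Φ, h1, h2, h3⟩
    refine ⟨⟨Φ, h1, h2⟩, Lp.ext ?_⟩
    exact (coeFn_contL2 h1.continuous).trans h3.symm
  · rintro ⟨φ, rfl⟩
    exact ⟨φ.1, φ.2.smooth, φ.2.per, coeFn_contL2 φ.2.continuous⟩

/-- `u` is a limit of smooth periodic functions whose first and second derivatives converge to `w`
and `H` in `L²(Y)`. -/
def IsH2Limit (u : L2Cell n) (w : Fin n → L2Cell n) (H : Fin n → Fin n → L2Cell n) : Prop :=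
  ∃ φ : ℕ → smoothPer n, Tendsto (fun k => toL2 (φ k)) atTop (𝓝 u) ∧
    (∀ i, Tendsto (fun k => toL2 (partialPer i (φ k))) atTop (𝓝 (w i))) ∧
    ∀ i j, Tendsto (fun k => toL2 (partialPer j (partialPer i (φ k)))) atTop (𝓝 (H i j))

/-- Together with its converse `IsH2Limit.memH2Per`, this lets identities for smooth periodic
functions pass to `H²_per` by L² limits. -/
theorem MemH2Per.isH2Limit {u : L2Cell n} (h : MemH2Per u) :
    IsH2Limit u (fun i => weakPartial i u) (fun i j => weakPartial j (weakPartial i u)) := by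
  have : ∀ k : ℕ, ∃ φ : smoothPer n, h2Norm (u - toL2 φ) < 1 / ((k : ℝ) + 1) := by
    intro k
    obtain ⟨φ, hφ, hlt⟩ := h.2 (1 / ((k : ℝ) + 1)) (by positivity)
    obtain ⟨φ, rfl⟩ := memSmoothPer_iff.1 hφ
    exact ⟨φ, hlt⟩
  choose φ hφ using this
  have hz : Tendsto (fun k : ℕ => 1 / ((k : ℝ) + 1)) atTop (𝓝 0) :=
    tendsto_one_div_add_atTop_nhds_zero_nat
  refine ⟨φ, ?_, fun i => ?_, fun i j => ?_⟩
  · refine tendsto_iff_norm_sub_tendsto_zero.2 (squeeze_zero (fun _ => norm_nonneg _)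
      (fun k => ?_) hz)
    rw [norm_sub_rev]
    exact (norm_le_h2Norm _).trans (hφ k).le
  · refine tendsto_iff_norm_sub_tendsto_zero.2 (squeeze_zero (fun _ => norm_nonneg _)
      (fun k => ?_) hz)
    rw [norm_sub_rev, ← weakPartial_toL2, ← h.1.weakPartial_sub (memH2_toL2 _)]
    exact (norm_weakPartial_le_h2Norm _ _).trans (hφ k).le
  · refine tendsto_iff_norm_sub_tendsto_zero.2 (squeeze_zero (fun _ => norm_nonneg _)
      (fun k => ?_) hz)
    rw [norm_sub_rev, ← weakPartial_toL2, ← weakPartial_toL2,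
      ← h.1.weakPartial₂_sub (memH2_toL2 _)]
    exact (norm_weakPartial₂_le_h2Norm _ _ _).trans (hφ k).le

namespace IsH2Limit

variable {u : L2Cell n} {w : Fin n → L2Cell n} {H : Fin n → Fin n → L2Cell n}

theorem isWeakPartial (h : IsH2Limit u w H) (i : Fin n) : IsWeakPartial i u (w i) := by
  obtain ⟨φ, h0, h1, -⟩ := h
  exact IsWeakPartial.of_tendsto (fun k => isWeakPartial_toL2 i (φ k)) h0 (h1 i)

theorem isWeakPartial₂ (h : IsH2Limit u w H) (i j : Fin n) : IsWeakPartial j (w i) (H i j) := by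
  obtain ⟨φ, -, h1, h2⟩ := h
  exact IsWeakPartial.of_tendsto (fun k => isWeakPartial_toL2 j (partialPer i (φ k))) (h1 i)
    (h2 i j)

theorem weakPartial_eq (h : IsH2Limit u w H) (i : Fin n) : weakPartial i u = w i :=
  (h.isWeakPartial i).weakPartial_eq

theorem weakPartial₂_eq (h : IsH2Limit u w H) (i j : Fin n) :
    weakPartial j (weakPartial i u) = H i j := by
  rw [h.weakPartial_eq]
  exact (h.isWeakPartial₂ i j).weakPartial_eq

theorem memH2Per (h : IsH2Limit u w H) : MemH2Per u := by
  have hu : MemH2 u := memH2_of_isWeakPartial h.isWeakPartial h.isWeakPartial₂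
  refine ⟨hu, fun ε hε => ?_⟩
  have hw := h.weakPartial_eq
  have hH := h.weakPartial₂_eq
  obtain ⟨φ, h0, h1, h2⟩ := h
  have hlim : Tendsto (fun k => h2Norm (u - toL2 (φ k))) atTop (𝓝 0) := by
    have : ∀ k, h2Norm (u - toL2 (φ k)) = √(‖u - toL2 (φ k)‖ ^ 2
        + ∑ i, ‖w i - toL2 (partialPer i (φ k))‖ ^ 2
        + ∑ i, ∑ j, ‖H i j - toL2 (partialPer j (partialPer i (φ k)))‖ ^ 2) := by
      intro k
      rw [h2Norm, h2Seminorm_sq]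
      simp only [hu.weakPartial₂_sub (memH2_toL2 _), weakPartial_toL2, hH]
      simp only [hu.weakPartial_sub (memH2_toL2 _), weakPartial_toL2, hw]
    simp only [this]
    have hz : (0 : ℝ) = √(‖u - u‖ ^ 2 + ∑ i, ‖w i - w i‖ ^ 2 + ∑ i, ∑ j, ‖H i j - H i j‖ ^ 2) := by
      simp
    rw [hz]
    refine (Real.continuous_sqrt.tendsto _).comp ?_
    exact (((h0.const_sub u).norm.pow 2).add
      (tendsto_finsetSum _ fun i _ => ((h1 i).const_sub (w i)).norm.pow 2)).add
      (tendsto_finsetSum _ fun i _ => tendsto_finsetSum _ fun j _ =>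
        ((h2 i j).const_sub (H i j)).norm.pow 2)
  obtain ⟨k, hk⟩ := (hlim.eventually (gt_mem_nhds hε)).exists
  exact ⟨toL2 (φ k), memSmoothPer_iff.2 ⟨_, rfl⟩, hk⟩

end IsH2Limit

theorem MemH2Per.sub {u v : L2Cell n} (hu : MemH2Per u) (hv : MemH2Per v) :
    MemH2Per (u - v) := by
  obtain ⟨φ, h0, h1, h2⟩ := hu.isH2Limit
  obtain ⟨ψ, k0, k1, k2⟩ := hv.isH2Limit
  refine IsH2Limit.memH2Per (w := fun i => weakPartial i u - weakPartial i v)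
    (H := fun i j => weakPartial j (weakPartial i u) - weakPartial j (weakPartial i v))
    ⟨fun k => φ k - ψ k, ?_, fun i => ?_, fun i j => ?_⟩
  · simpa using h0.sub k0
  · simpa using (h1 i).sub (k1 i)
  · simpa using (h2 i j).sub (k2 i j)

/-! ### The shifted Laplacian: norm identity and closed range -/

/-- The operator `μ - Δ` on `C^∞_per(Y)`. -/
def shiftedLaplacePer (μ : ℝ) : smoothPer n →ₗ[ℝ] smoothPer n :=
  μ • LinearMap.id - ∑ i, partialPer i ∘ₗ partialPer i

theorem toL2_shiftedLaplacePer (μ : ℝ) (φ : smoothPer n) :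
    toL2 (shiftedLaplacePer μ φ) = μ • toL2 φ - ∑ i, toL2 (partialPer i (partialPer i φ)) := by
  simp [shiftedLaplacePer, map_sum]

/-- Expand the square. One integration by parts turns `⟨φ, ∂ᵢ∂ᵢφ⟩` into `-‖∂ᵢφ‖²`; two of them, with
commuting derivatives, turn `⟨∂ᵢ∂ᵢφ, ∂ⱼ∂ⱼφ⟩` into `‖∂ᵢ∂ⱼφ‖²`. -/
theorem norm_sq_shiftedLaplacePer (μ : ℝ) (φ : smoothPer n) :
    ‖toL2 (shiftedLaplacePer μ φ)‖ ^ 2 = μ ^ 2 * ‖toL2 φ‖ ^ 2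
      + 2 * μ * ∑ i, ‖toL2 (partialPer i φ)‖ ^ 2
      + ∑ i, ∑ j, ‖toL2 (partialPer j (partialPer i φ))‖ ^ 2 := by
  have h1 : ∀ i, inner ℝ (toL2 φ) (toL2 (partialPer i (partialPer i φ)))
      = -‖toL2 (partialPer i φ)‖ ^ 2 := by
    intro i
    have := inner_partialPer_left i φ (partialPer i φ)
    rw [real_inner_self_eq_norm_sq] at this
    linarith
  have h2 : ∀ i j, inner ℝ (toL2 (partialPer i (partialPer i φ)))
      (toL2 (partialPer j (partialPer j φ))) = ‖toL2 (partialPer i (partialPer j φ))‖ ^ 2 := by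
    intro i j
    rw [inner_partialPer_left, partialPer_comm i j, partialPer_comm i j, ← inner_partialPer_left,
      real_inner_self_eq_norm_sq, partialPer_comm]
  rw [toL2_shiftedLaplacePer, norm_sub_sq_real, norm_smul, inner_smul_left, inner_sum,
    ← real_inner_self_eq_norm_sq (∑ i, _)]
  simp only [sum_inner, inner_sum, h1, h2, mul_pow, Real.norm_eq_abs, sq_abs, conj_trivial,
    Finset.sum_neg_distrib]
  ring

/-- The operator `μ - Δ` in terms of weak derivatives. -/
def shiftedLaplace (μ : ℝ) (u : L2Cell n) : L2Cell n :=
  μ • u - ∑ i, weakPartial i (weakPartial i u)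

theorem MemH2Per.norm_sq_shiftedLaplace {u : L2Cell n} (h : MemH2Per u) (μ : ℝ) :
    ‖shiftedLaplace μ u‖ ^ 2 = μ ^ 2 * ‖u‖ ^ 2 + 2 * μ * ∑ i, ‖weakPartial i u‖ ^ 2
      + ∑ i, ∑ j, ‖weakPartial j (weakPartial i u)‖ ^ 2 := by
  obtain ⟨φ, h0, h1, h2⟩ := h.isH2Limit
  have hL : Tendsto (fun k => ‖toL2 (shiftedLaplacePer μ (φ k))‖ ^ 2) atTop
      (𝓝 (‖shiftedLaplace μ u‖ ^ 2)) := by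
    simp only [toL2_shiftedLaplacePer]
    exact (((h0.const_smul μ).sub (tendsto_finsetSum _ fun i _ => h2 i i)).norm).pow 2
  refine tendsto_nhds_unique hL ?_
  simp only [norm_sq_shiftedLaplacePer]
  exact (((h0.norm.pow 2).const_mul _).add ((tendsto_finsetSum _ fun i _ =>
    (h1 i).norm.pow 2).const_mul _)).add (tendsto_finsetSum _ fun i _ =>
      tendsto_finsetSum _ fun j _ => (h2 i j).norm.pow 2)

/-- The range of `μ - Δ` on `H²_per(Y)` is closed. -/
theorem exists_memH2Per_of_tendsto {μ : ℝ} (hμ : 0 < μ) {φ : ℕ → smoothPer n} {h : L2Cell n}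
    (hφ : Tendsto (fun k => toL2 (shiftedLaplacePer μ (φ k))) atTop (𝓝 h)) :
    ∃ u : L2Cell n, MemH2Per u ∧ shiftedLaplace μ u = h := by
  -- Used for `T` the identity, `∂ᵢ` and `∂ⱼ∂ᵢ`, with `c = μ²`, `2μ` and `1`, the coefficients in
  -- the norm identity: each sequence inherits the Cauchy property.
  have hlim : ∀ (T : smoothPer n →ₗ[ℝ] L2Cell n) (c : ℝ), 0 < c →
      (∀ ψ, c * ‖T ψ‖ ^ 2 ≤ ‖toL2 (shiftedLaplacePer μ ψ)‖ ^ 2) →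
      ∃ w, Tendsto (fun k => T (φ k)) atTop (𝓝 w) := by
    intro T c hc hT
    refine cauchySeq_tendsto_of_complete (Metric.cauchySeq_iff.2 fun ε hε => ?_)
    obtain ⟨N, hN⟩ := Metric.cauchySeq_iff.1 hφ.cauchySeq (√c * ε) (by positivity)
    refine ⟨N, fun k hk l hl => ?_⟩
    have h1 := hN k hk l hl
    rw [dist_eq_norm, ← map_sub, ← map_sub] at h1
    rw [dist_eq_norm, ← map_sub]
    have h2 := hT (φ k - φ l)
    have h3 : √c * ‖T (φ k - φ l)‖ ≤ ‖toL2 (shiftedLaplacePer μ (φ k - φ l))‖ := by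
      refine abs_le_of_sq_le_sq' ?_ (norm_nonneg _) |>.2
      rwa [mul_pow, Real.sq_sqrt hc.le]
    exact lt_of_mul_lt_mul_left (h3.trans_lt h1) (Real.sqrt_nonneg c)
  have hz0 : ∀ ψ : smoothPer n, 0 ≤ μ ^ 2 * ‖toL2 ψ‖ ^ 2 := fun _ => by positivity
  have hz1 : ∀ ψ : smoothPer n, 0 ≤ ∑ i, ‖toL2 (partialPer i ψ)‖ ^ 2 := fun _ => by positivity
  have hz2 : ∀ ψ : smoothPer n, 0 ≤ ∑ i, ∑ j, ‖toL2 (partialPer j (partialPer i ψ))‖ ^ 2 :=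
    fun _ => by positivity
  have hb0 : ∀ ψ : smoothPer n, μ ^ 2 * ‖toL2 ψ‖ ^ 2 ≤ ‖toL2 (shiftedLaplacePer μ ψ)‖ ^ 2 := by
    intro ψ
    rw [norm_sq_shiftedLaplacePer]
    nlinarith [mul_nonneg hμ.le (hz1 ψ), hz2 ψ]
  have hb1 : ∀ (i : Fin n) (ψ : smoothPer n),
      (2 * μ) * ‖toL2 (partialPer i ψ)‖ ^ 2 ≤ ‖toL2 (shiftedLaplacePer μ ψ)‖ ^ 2 := by
    intro i ψ
    rw [norm_sq_shiftedLaplacePer]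
    have := mul_le_mul_of_nonneg_left (Finset.single_le_sum
      (f := fun i => ‖toL2 (partialPer i ψ)‖ ^ 2) (fun _ _ => by positivity) (Finset.mem_univ i))
      (by positivity : 0 ≤ 2 * μ)
    linarith [hz0 ψ, hz2 ψ]
  have hb2 : ∀ (i j : Fin n) (ψ : smoothPer n),
      1 * ‖toL2 (partialPer j (partialPer i ψ))‖ ^ 2 ≤ ‖toL2 (shiftedLaplacePer μ ψ)‖ ^ 2 := by
    intro i j ψ
    rw [norm_sq_shiftedLaplacePer]
    have h1 := Finset.single_le_sum (f := fun j => ‖toL2 (partialPer j (partialPer i ψ))‖ ^ 2)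
      (fun _ _ => by positivity) (Finset.mem_univ j)
    have h2 := Finset.single_le_sum
      (f := fun i => ∑ j, ‖toL2 (partialPer j (partialPer i ψ))‖ ^ 2)
      (fun _ _ => by positivity) (Finset.mem_univ i)
    nlinarith [hz0 ψ, mul_nonneg hμ.le (hz1 ψ)]
  obtain ⟨u, hu⟩ := hlim toL2 _ (by positivity) hb0
  choose w hw using fun i => hlim (toL2 ∘ₗ partialPer i) _ (by positivity) (hb1 i)
  choose H hH using fun i j =>
    hlim (toL2 ∘ₗ partialPer j ∘ₗ partialPer i) _ one_pos (hb2 i j)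
  have hlimit : IsH2Limit u w H := ⟨φ, hu, hw, hH⟩
  refine ⟨u, hlimit.memH2Per, ?_⟩
  refine tendsto_nhds_unique ?_ hφ
  simp only [toL2_shiftedLaplacePer, shiftedLaplace, hlimit.weakPartial₂_eq]
  exact (hu.const_smul μ).sub (tendsto_finsetSum _ fun i _ => hH i i)

/-! ### Fourier analysis and surjectivity -/

/-- The phase function `y ↦ 2π k · y`. -/
def phase (k : Fin n → ℤ) : (Fin n → ℝ) →L[ℝ] ℝ :=
  ∑ i, (2 * Real.pi * k i) • ContinuousLinearMap.proj i

theorem phase_apply (k : Fin n → ℤ) (y : Fin n → ℝ) :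
    phase k y = ∑ i, 2 * Real.pi * k i * y i := by
  simp [phase]

theorem phase_single (k : Fin n → ℤ) (i : Fin n) : phase k (Pi.single i 1) = 2 * Real.pi * k i := by
  simp [phase_apply, Pi.single_apply]

/-- The trigonometric function `y ↦ cos (2π k · y + θ)`. -/
def trigPer (k : Fin n → ℤ) (θ : ℝ) : smoothPer n :=
  ⟨fun y => Real.cos (phase k y + θ), by
    refine ⟨Real.contDiff_cos.comp ((phase k).contDiff.add contDiff_const), fun y l => ?_⟩
    have h : phase k (fun i => (l i : ℝ)) = ((∑ i, k i * l i : ℤ) : ℝ) * (2 * Real.pi) := by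
      rw [phase_apply]
      push_cast
      rw [Finset.sum_mul]
      exact Finset.sum_congr rfl fun i _ => by ring
    simp only [map_add, h]
    rw [add_right_comm, Real.cos_add_int_mul_two_pi]⟩

theorem partialPer_trigPer (i : Fin n) (k : Fin n → ℤ) (θ : ℝ) :
    partialPer i (trigPer k θ) = (2 * Real.pi * k i) • trigPer k (θ + Real.pi / 2) := by
  refine Subtype.ext (funext fun y => ?_)
  change fderiv ℝ (fun y => Real.cos (phase k y + θ)) y (Pi.single i 1)
    = (2 * Real.pi * k i) * Real.cos (phase k y + (θ + Real.pi / 2))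
  have h : HasFDerivAt (fun y => Real.cos (phase k y + θ))
      (-Real.sin (phase k y + θ) • phase k) y :=
    ((phase k).hasFDerivAt.add_const θ).cos
  rw [h.fderiv, ← add_assoc, Real.cos_add_pi_div_two]
  simp only [FunLike.coe_smul, Pi.smul_apply, phase_single, smul_eq_mul]
  ring

theorem trigPer_add_pi (k : Fin n → ℤ) (θ : ℝ) :
    trigPer k (θ + Real.pi / 2 + Real.pi / 2) = -trigPer k θ := by
  refine Subtype.ext (funext fun y => ?_)
  change Real.cos (phase k y + (θ + Real.pi / 2 + Real.pi / 2)) = -Real.cos (phase k y + θ)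
  rw [← Real.cos_add_pi]
  congr 1
  ring

/-- Differentiation shifts the phase by `π/2`, so two derivatives change the sign: these are
eigenfunctions, with positive eigenvalue when `μ > 0`. -/
theorem shiftedLaplacePer_trigPer (μ : ℝ) (k : Fin n → ℤ) (θ : ℝ) :
    shiftedLaplacePer μ (trigPer k θ)
      = (μ + ∑ i, (2 * Real.pi * k i) ^ 2) • trigPer k θ := by
  simp only [shiftedLaplacePer, LinearMap.sub_apply, LinearMap.smul_apply, LinearMap.id_apply,
    LinearMap.sum_apply, LinearMap.comp_apply, partialPer_trigPer, map_smul, trigPer_add_pi,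
    smul_neg, Finset.sum_neg_distrib, sub_neg_eq_add, add_smul, Finset.sum_smul, smul_smul, pow_two]

-- The Fourier theory of `UnitAddTorus` is stated for the normalized Haar measure on each circle.
local instance : MeasureSpace UnitAddCircle := ⟨AddCircle.haarAddCircle⟩

local instance : IsProbabilityMeasure (volume : Measure UnitAddCircle) :=
  inferInstanceAs (IsProbabilityMeasure AddCircle.haarAddCircle)

theorem mFourier_coe (k : Fin n → ℤ) (y : Fin n → ℝ) :
    UnitAddTorus.mFourier (-k) (fun i => (y i : UnitAddCircle))
      = Real.cos (phase k y) + Real.cos (phase k y + Real.pi / 2) * Complex.I := by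
  have : UnitAddTorus.mFourier (-k) (fun i => (y i : UnitAddCircle))
      = Complex.exp ((-(phase k y) : ℝ) * Complex.I) := by
    simp only [UnitAddTorus.mFourier, ContinuousMap.coe_mk, fourier_coe_apply, phase_apply]
    rw [← Complex.exp_sum]
    congr 1
    push_cast
    rw [neg_mul, Finset.sum_mul, ← Finset.sum_neg_distrib]
    refine Finset.sum_congr rfl fun i _ => ?_
    simp
    ring
  rw [this, Complex.exp_mul_I, ← Complex.ofReal_cos, ← Complex.ofReal_sin, Real.cos_neg,
    Real.sin_neg, Real.cos_add_pi_div_two]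

theorem unitCell_ae_eq_Ioc (n : ℕ) :
    unitCell n =ᵐ[volume] {y : Fin n → ℝ | ∀ i, y i ∈ Ioc ((0 : Fin n → ℝ) i)
      ((0 : Fin n → ℝ) i + 1)} := by
  have h : {y : Fin n → ℝ | ∀ i, y i ∈ Ioc ((0 : Fin n → ℝ) i) ((0 : Fin n → ℝ) i + 1)}
      = Set.pi univ fun _ => Ioc (0 : ℝ) 1 := by
    ext y; simp
  rw [h, unitCell_eq_pi]
  exact Measure.univ_pi_Ioo_ae_eq_Icc.trans Measure.univ_pi_Ioc_ae_eq_Icc.symm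

/-- Completeness of the trigonometric system in `L²(Y)`. -/
theorem eq_zero_of_inner_trigPer {h : L2Cell n}
    (hh : ∀ (k : Fin n → ℤ) (θ : ℝ), inner ℝ (toL2 (trigPer k θ)) h = 0) : h = 0 := by
  let Q : Set (Fin n → ℝ) :=
    {y | ∀ i, y i ∈ Ioc ((0 : Fin n → ℝ) i) ((0 : Fin n → ℝ) i + 1)}
  have hQ : MeasurableSet Q := MeasurableSet.univ_pi' fun _ => measurableSet_Ioc
  have hres : (volume.restrict Q : Measure (Fin n → ℝ)) = cellMeasure n :=
    (Measure.restrict_congr_set (unitCell_ae_eq_Ioc n)).symm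
  have hmeas : Measurable (h : (Fin n → ℝ) → ℝ) := (Lp.stronglyMeasurable h).measurable
  let e := UnitAddTorus.measurableEquivPiIoc (0 : Fin n → ℝ)
  -- `h` transported to the torus and made complex-valued.
  let F : UnitAddTorus (Fin n) → ℂ := fun x => (h (e x).1 : ℂ)
  have hF : Measurable F :=
    Complex.measurable_ofReal.comp (hmeas.comp (measurable_subtype_coe.comp e.measurable))
  have hFe : ∀ y ∈ Q, F (fun i => (y i : UnitAddCircle)) = h y := by
    intro y hy
    have : e (fun i => (y i : UnitAddCircle)) = ⟨y, hy⟩ := e.apply_symm_apply ⟨y, hy⟩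
    simp only [F, this]
  have hint : ∫⁻ x, ‖F x‖ₑ ^ (2 : ℝ) = ∫⁻ y in unitCell n, ‖h y‖ₑ ^ (2 : ℝ) := by
    rw [UnitAddTorus.lintegral_preimage (fun x => ‖F x‖ₑ ^ (2 : ℝ)) 0]
    refine Eq.trans ?_ (setLIntegral_congr (unitCell_ae_eq_Ioc n).symm)
    refine setLIntegral_congr_fun hQ fun y hy => ?_
    simp only [hFe y hy]
    rw [← ofReal_norm, Complex.norm_real, ofReal_norm]
  have hFL : MemLp F 2 volume := by
    refine ⟨hF.aestronglyMeasurable, ?_⟩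
    rw [eLpNorm_lt_top_iff_lintegral_rpow_enorm_lt_top (by simp) (by simp),
      ENNReal.toReal_ofNat, hint]
    have := (eLpNorm_lt_top_iff_lintegral_rpow_enorm_lt_top (p := 2) (by simp) (by simp)).1
      (Lp.memLp h).2
    rwa [ENNReal.toReal_ofNat] at this
  have hcoeff : ∀ k : Fin n → ℤ, UnitAddTorus.mFourierCoeff F k = 0 := by
    intro k
    rw [UnitAddTorus.mFourierCoeff_eq_integral F k 0]
    have hkey : ∀ θ : ℝ, ∫ y in Q, h y * Real.cos (phase k y + θ) = 0 := by
      intro θ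
      rw [hres]
      exact (inner_contL2 (trigPer k θ).2.continuous h).symm.trans (hh k θ)
    have hI : ∀ θ : ℝ, Integrable (fun y => h y * Real.cos (phase k y + θ))
        (volume.restrict Q) := by
      intro θ
      rw [hres]
      exact (Lp.memLp h).integrable_mul (memLp_of_continuous (trigPer k θ).2.continuous)
    -- The real and imaginary parts of each coefficient are the pairings of `h` with `trigPer k 0`
    -- and `trigPer k (π/2)`.
    have h1 : ∫ y in Q, UnitAddTorus.mFourier (-k) (fun i => (y i : UnitAddCircle)) •
          F (fun i => (y i : UnitAddCircle))
        = ∫ y in Q, (((h y * Real.cos (phase k y + 0) : ℝ) : ℂ)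
          + ((h y * Real.cos (phase k y + Real.pi / 2) : ℝ) : ℂ) * Complex.I) := by
      refine setIntegral_congr_fun hQ fun y hy => ?_
      simp only [hFe y hy, mFourier_coe, smul_eq_mul, add_zero]
      push_cast
      ring
    refine h1.trans ?_
    rw [integral_add (hI 0).ofReal ((hI _).ofReal.mul_const _), integral_mul_const,
      integral_complex_ofReal, integral_complex_ofReal, hkey, hkey]
    simp
  have hzero : hFL.toLp F = 0 := by
    have h1 := UnitAddTorus.hasSum_mFourier_series_L2 (hFL.toLp F)
    have h2 : ∀ k, UnitAddTorus.mFourierCoeff (hFL.toLp F) k = 0 := by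
      intro k
      rw [← hcoeff k]
      refine integral_congr_ae ?_
      filter_upwards [hFL.coeFn_toLp] with x hx
      rw [hx]
    simp only [h2, zero_smul] at h1
    exact h1.unique hasSum_zero
  have hF0 : F =ᵐ[volume] 0 :=
    hFL.coeFn_toLp.symm.trans ((Lp.eq_zero_iff_ae_eq_zero).1 hzero)
  have h0 : ∫⁻ y in unitCell n, ‖h y‖ₑ ^ (2 : ℝ) = 0 := by
    rw [← hint, lintegral_eq_zero_iff (by fun_prop)]
    filter_upwards [hF0] with x hx
    simp [hx]
  rw [lintegral_eq_zero_iff (by fun_prop)] at h0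
  refine Lp.eq_zero_iff_ae_eq_zero.2 ?_
  filter_upwards [h0] with y hy
  simpa using hy

/-- `μ - Δ` maps `H²_per(Y)` onto `L²(Y)`. -/
theorem exists_shiftedLaplace_eq {μ : ℝ} (hμ : 0 < μ) (h : L2Cell n) :
    ∃ u : L2Cell n, MemH2Per u ∧ shiftedLaplace μ u = h := by
  let K : Submodule ℝ (L2Cell n) := LinearMap.range (toL2 ∘ₗ shiftedLaplacePer (n := n) μ)
  -- A vector orthogonal to the range is orthogonal to each eigenfunction, as the eigenvalue is
  -- nonzero.
  have hK : K.topologicalClosure = ⊤ := by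
    rw [Submodule.topologicalClosure_eq_top_iff, Submodule.eq_bot_iff]
    intro g hg
    refine eq_zero_of_inner_trigPer fun k θ => ?_
    have h1 := (Submodule.mem_orthogonal K g).1 hg (toL2 (shiftedLaplacePer μ (trigPer k θ)))
      ⟨trigPer k θ, rfl⟩
    rw [shiftedLaplacePer_trigPer, map_smul, inner_smul_left] at h1
    refine (mul_eq_zero.1 h1).resolve_left ?_
    have : 0 < μ + ∑ i, (2 * Real.pi * k i) ^ 2 := by positivity
    simpa using this.ne'
  have hmem : h ∈ closure (K : Set (L2Cell n)) := by
    rw [← Submodule.topologicalClosure_coe, hK]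
    trivial
  obtain ⟨g, hg, hlim⟩ := mem_closure_iff_seq_limit.1 hmem
  choose φ hφ using hg
  refine exists_memH2Per_of_tendsto hμ (φ := φ) ?_
  have : (fun k => toL2 (shiftedLaplacePer μ (φ k))) = g := funext hφ
  rwa [this]

/-! ### From pointwise bounds to L² bounds -/

theorem norm_sq_eq_integral (u : L2Cell n) : ‖u‖ ^ 2 = ∫ y in unitCell n, u y ^ 2 := by
  rw [← real_inner_self_eq_norm_sq, L2.inner_def]
  refine integral_congr_ae (ae_of_all _ fun y => ?_)
  simp [pow_two]

theorem integrable_sq (u : L2Cell n) : Integrable (fun y => u y ^ 2) (cellMeasure n) :=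
  (Lp.memLp u).integrable_sq

theorem shiftedLaplace_ae (μ : ℝ) (u : L2Cell n) : shiftedLaplace μ u =ᵐ[cellMeasure n]
    fun y => μ * u y - (weakHessian u y).trace := by
  have h1 := Lp.coeFn_sub (μ • u) (∑ i, weakPartial i (weakPartial i u))
  have h3 := Lp.coeFn_fun_finsetSum Finset.univ fun i : Fin n => weakPartial i (weakPartial i u)
  filter_upwards [h1, Lp.coeFn_smul μ u, h3] with y h1 h2 h3
  rw [shiftedLaplace, h1, Pi.sub_apply, h2, h3]
  rfl

theorem weakHessian_sub_ae {u v : L2Cell n} (hu : MemH2 u) (hv : MemH2 v) :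
    ∀ᵐ y ∂cellMeasure n, weakHessian (u - v) y = weakHessian u y - weakHessian v y := by
  have : ∀ i j, ∀ᵐ y ∂cellMeasure n, weakPartial j (weakPartial i (u - v)) y
      = weakPartial j (weakPartial i u) y - weakPartial j (weakPartial i v) y := by
    intro i j
    rw [hu.weakPartial₂_sub hv]
    exact Lp.coeFn_sub _ _
  filter_upwards [ae_all_iff.2 fun i => ae_all_iff.2 (this i)] with y hy
  ext i j
  exact hy i j

theorem memH2Per_zero : MemH2Per (0 : L2Cell n) := by
  refine IsH2Limit.memH2Per (w := 0) (H := 0) ⟨fun _ => 0, ?_, fun i => ?_, fun i j => ?_⟩ <;>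
    simp

theorem weakHessian_zero_ae : ∀ᵐ y ∂cellMeasure n, weakHessian (0 : L2Cell n) y = 0 := by
  filter_upwards [weakHessian_sub_ae (memH2Per_zero (n := n)).1 memH2Per_zero.1] with y hy
  rwa [sub_self, sub_self] at hy

theorem shiftedLaplace_sub {u v : L2Cell n} (hu : MemH2 u) (hv : MemH2 v) (μ : ℝ) :
    shiftedLaplace μ (u - v) = shiftedLaplace μ u - shiftedLaplace μ v := by
  simp only [shiftedLaplace, hu.weakPartial₂_sub hv, smul_sub, Finset.sum_sub_distrib]
  abel

theorem shiftedLaplace_zero (μ : ℝ) : shiftedLaplace μ (0 : L2Cell n) = 0 := by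
  have := shiftedLaplace_sub (memH2Per_zero (n := n)).1 memH2Per_zero.1 μ
  rwa [sub_self, sub_self] at this

theorem MemH2Per.norm_sq_le_shiftedLaplace {u : L2Cell n} (h : MemH2Per u) {μ : ℝ} (hμ : 0 < μ) :
    μ ^ 2 * ‖u‖ ^ 2 + h2Seminorm u ^ 2 ≤ ‖shiftedLaplace μ u‖ ^ 2 := by
  rw [h.norm_sq_shiftedLaplace, h2Seminorm_sq]
  have : 0 ≤ 2 * μ * ∑ i, ‖weakPartial i u‖ ^ 2 := by positivity
  linarith

theorem MemH2Per.h2Seminorm_le {u : L2Cell n} (h : MemH2Per u) {μ : ℝ} (hμ : 0 < μ) :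
    h2Seminorm u ≤ ‖shiftedLaplace μ u‖ := by
  refine abs_le_of_sq_le_sq' ?_ (norm_nonneg _) |>.2
  have := h.norm_sq_le_shiftedLaplace hμ
  nlinarith [mul_nonneg (sq_nonneg μ) (sq_nonneg ‖u‖)]

theorem MemH2Per.eq_of_shiftedLaplace_eq {u v : L2Cell n} (hu : MemH2Per u) (hv : MemH2Per v)
    {μ : ℝ} (hμ : 0 < μ) (h : shiftedLaplace μ u = shiftedLaplace μ v) : u = v := by
  have h1 := (hu.sub hv).norm_sq_le_shiftedLaplace hμ
  rw [shiftedLaplace_sub hu.1 hv.1, h, sub_self, norm_zero] at h1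
  have h2 : μ ^ 2 * ‖u - v‖ ^ 2 = 0 := by
    nlinarith [mul_nonneg (sq_nonneg μ) (sq_nonneg ‖u - v‖), sq_nonneg (h2Seminorm (u - v))]
  have h3 : ‖u - v‖ = 0 := by
    simpa [hμ.ne'] using h2
  exact sub_eq_zero.1 (norm_eq_zero.1 h3)

theorem frob_self_nonneg (N : Matrix (Fin n) (Fin n) ℝ) : 0 ≤ frob N N :=
  Finset.sum_nonneg fun i _ => Finset.sum_nonneg fun j _ => mul_self_nonneg (N i j)

theorem sqrt_frob_add_sq_le (N : Matrix (Fin n) (Fin n) ℝ) (s : ℝ) :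
    √(frob N N + s ^ 2) ≤ (∑ i, ∑ j, |N i j|) + |s| := by
  refine Real.sqrt_le_iff.2 ⟨by positivity, ?_⟩
  have h1 : frob N N ≤ (∑ i, ∑ j, |N i j|) ^ 2 := by
    calc frob N N = ∑ i, ∑ j, |N i j| ^ 2 := by simp [frob, ← pow_two]
      _ ≤ ∑ i, (∑ j, |N i j|) ^ 2 :=
          Finset.sum_le_sum fun i _ => Finset.sum_sq_le_sq_sum_of_nonneg fun _ _ => abs_nonneg _
      _ ≤ _ := Finset.sum_sq_le_sq_sum_of_nonneg fun _ _ => by positivity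
  have h2 : 0 ≤ (∑ i, ∑ j, |N i j|) * |s| := by positivity
  rw [add_sq, sq_abs]
  linarith

/-- Squaring and integrating gives `ε² (‖∇²w‖² + μ²‖w‖²)`, and the norm identity exceeds the bracket
only by the nonnegative gradient term. -/
theorem norm_le_of_ae_le_frob {w d : L2Cell n} (hw : MemH2Per w) {μ ε : ℝ} (hμ : 0 < μ)
    (hε : 0 ≤ ε) (hd : ∀ᵐ y ∂cellMeasure n,
      |d y| ≤ ε * √(frob (weakHessian w y) (weakHessian w y) + (μ * w y) ^ 2)) :
    ‖d‖ ≤ ε * ‖shiftedLaplace μ w‖ := by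
  refine abs_le_of_sq_le_sq' ?_ (by positivity) |>.2
  have hI : ∀ i j, Integrable (fun y => weakPartial j (weakPartial i w) y ^ 2) (cellMeasure n) :=
    fun i j => integrable_sq _
  have hsum : Integrable (fun y => ∑ i, ∑ j, weakPartial j (weakPartial i w) y ^ 2)
      (cellMeasure n) :=
    integrable_finsetSum _ fun i _ => integrable_finsetSum _ fun j _ => hI i j
  have hH : ∫ y in unitCell n, ∑ i, ∑ j, weakPartial j (weakPartial i w) y ^ 2
      = h2Seminorm w ^ 2 := by
    rw [h2Seminorm_sq, integral_finsetSum Finset.univ fun i _ =>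
      integrable_finsetSum Finset.univ fun j _ => hI i j]
    refine Finset.sum_congr rfl fun i _ => ?_
    rw [integral_finsetSum Finset.univ fun j _ => hI i j]
    exact Finset.sum_congr rfl fun j _ => (norm_sq_eq_integral _).symm
  calc ‖d‖ ^ 2 = ∫ y in unitCell n, d y ^ 2 := norm_sq_eq_integral d
    _ ≤ ∫ y in unitCell n, ε ^ 2 * ((∑ i, ∑ j, weakPartial j (weakPartial i w) y ^ 2)
          + μ ^ 2 * w y ^ 2) := by
        refine integral_mono_ae (integrable_sq d)
          ((hsum.add ((integrable_sq w).const_mul _)).const_mul _) ?_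
        filter_upwards [hd] with y hy
        have h0 : 0 ≤ frob (weakHessian w y) (weakHessian w y) + (μ * w y) ^ 2 :=
          add_nonneg (frob_self_nonneg _) (sq_nonneg _)
        have h1 : |d y| ^ 2 ≤ _ := pow_le_pow_left₀ (abs_nonneg _) hy 2
        rw [sq_abs, mul_pow, Real.sq_sqrt h0, mul_pow] at h1
        simpa [frob, weakHessian, ← pow_two] using h1
    _ = ε ^ 2 * (h2Seminorm w ^ 2 + μ ^ 2 * ‖w‖ ^ 2) := by
        rw [integral_const_mul, integral_add hsum ((integrable_sq w).const_mul _),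
          integral_const_mul, hH, norm_sq_eq_integral w]
    _ ≤ (ε * ‖shiftedLaplace μ w‖) ^ 2 := by
        rw [mul_pow]
        have := hw.norm_sq_le_shiftedLaplace hμ
        exact mul_le_mul_of_nonneg_left (by linarith) (sq_nonneg ε)

/-! ### Nonlinear operators near the shifted Laplacian -/

/-- `Ψ(y, N, r)` is a continuous nonlinearity that is close to the linear operator `μ r - tr N`, with
a relative error at most `ε`. -/
structure NearLaplace (Ψ : (Fin n → ℝ) → Matrix (Fin n) (Fin n) ℝ → ℝ → ℝ) (μ ε : ℝ) : Prop where
  continuous : Continuous fun z : (Fin n → ℝ) × (Fin n → Fin n → ℝ) × ℝ =>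
    Ψ z.1 (Matrix.of z.2.1) z.2.2
  near : ∀ y N N' r r', |Ψ y N r - Ψ y N' r' - (μ * (r - r') - (N - N').trace)|
    ≤ ε * √(frob (N - N') (N - N') + (μ * (r - r')) ^ 2)

namespace NearLaplace

variable {Ψ : (Fin n → ℝ) → Matrix (Fin n) (Fin n) ℝ → ℝ → ℝ} {μ ε : ℝ}

theorem continuous_zero (h : NearLaplace Ψ μ ε) : Continuous fun y => Ψ y 0 0 :=
  h.continuous.comp (continuous_id.prodMk (continuous_const (y := ((0 : Fin n → Fin n → ℝ), 0))))

theorem aestronglyMeasurable (h : NearLaplace Ψ μ ε) (u : L2Cell n) :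
    AEStronglyMeasurable (fun y => Ψ y (weakHessian u y) (u y)) (cellMeasure n) := by
  have hH : AEMeasurable (fun y => fun i j => weakPartial j (weakPartial i u) y)
      (cellMeasure n) :=
    aemeasurable_pi_lambda _ fun i => aemeasurable_pi_lambda _ fun j =>
      (Lp.aestronglyMeasurable (weakPartial j (weakPartial i u))).aemeasurable
  have hz : AEMeasurable (fun y => (y, (fun i j => weakPartial j (weakPartial i u) y), u y))
      (cellMeasure n) :=
    aemeasurable_id.prodMk (hH.prodMk (Lp.aestronglyMeasurable u).aemeasurable)
  exact (h.continuous.measurable.comp_aemeasurable hz).aestronglyMeasurable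

/-- Split `Ψ` into its value at `(y, 0, 0)`, which is continuous in `y`, the linear part `μ u - tr
∇²u`, and a remainder dominated through `near`. -/
theorem memLp (h : NearLaplace Ψ μ ε) (hε : 0 ≤ ε) (u : L2Cell n) :
    MemLp (fun y => Ψ y (weakHessian u y) (u y)) 2 (cellMeasure n) := by
  have hlap : MemLp (fun y => μ * u y - (weakHessian u y).trace) 2 (cellMeasure n) :=
    (memLp_congr_ae (shiftedLaplace_ae μ u)).1 (Lp.memLp _)
  have h0 := memLp_of_continuous h.continuous_zero
  have hdom : MemLp (fun y => (∑ i, ∑ j, |weakPartial j (weakPartial i u) y|) + |μ * u y|) 2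
      (cellMeasure n) :=
    (memLp_finsetSum Finset.univ fun i _ => memLp_finsetSum Finset.univ fun j _ =>
      (Lp.memLp (weakPartial j (weakPartial i u))).abs).add ((Lp.memLp u).const_mul μ).abs
  have hrest : MemLp (fun y => Ψ y (weakHessian u y) (u y) - Ψ y 0 0
      - (μ * u y - (weakHessian u y).trace)) 2 (cellMeasure n) := by
    refine (hdom.const_mul ε).mono
      (((h.aestronglyMeasurable u).sub h0.1).sub hlap.1) (ae_of_all _ fun y => ?_)
    have h1 := h.near y (weakHessian u y) 0 (u y) 0
    rw [sub_zero, sub_zero] at h1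
    rw [Real.norm_eq_abs, Real.norm_eq_abs]
    refine h1.trans (le_trans ?_ (le_abs_self _))
    exact mul_le_mul_of_nonneg_left (sqrt_frob_add_sq_le _ _) hε
  refine (memLp_congr_ae (ae_of_all _ fun y => ?_)).1 ((hrest.add hlap).add h0)
  simp only [Pi.add_apply]
  ring

/-- The nonlinear operator `u ↦ Ψ(·, ∇²u, u)`. -/
def op (h : NearLaplace Ψ μ ε) (hε : 0 ≤ ε) (u : L2Cell n) : L2Cell n :=
  (h.memLp hε u).toLp _

theorem op_ae (h : NearLaplace Ψ μ ε) (hε : 0 ≤ ε) (u : L2Cell n) :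
    h.op hε u =ᵐ[cellMeasure n] fun y => Ψ y (weakHessian u y) (u y) :=
  MemLp.coeFn_toLp _

theorem op_eq_zero_iff (h : NearLaplace Ψ μ ε) (hε : 0 ≤ ε) (u : L2Cell n) :
    h.op hε u = 0 ↔ ∀ᵐ y ∂cellMeasure n, Ψ y (weakHessian u y) (u y) = 0 := by
  rw [Lp.eq_zero_iff_ae_eq_zero]
  constructor <;> intro h'
  · filter_upwards [h', h.op_ae hε u] with y h1 h2
    rw [← h2, h1]
    rfl
  · filter_upwards [h', h.op_ae hε u] with y h1 h2
    rw [h2, h1]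
    rfl

theorem op_zero (h : NearLaplace Ψ μ ε) (hε : 0 ≤ ε) :
    h.op hε 0 = contL2 (fun y => Ψ y 0 0) h.continuous_zero := by
  refine Lp.ext ?_
  filter_upwards [h.op_ae hε 0, coeFn_contL2 h.continuous_zero, weakHessian_zero_ae,
    Lp.coeFn_zero ℝ 2 (cellMeasure n)] with y h1 h2 h3 h4
  rw [h1, h2, h3, h4]
  rfl

theorem norm_sub_op_le (h : NearLaplace Ψ μ ε) (hμ : 0 < μ) (hε : 0 ≤ ε) {u v : L2Cell n}
    (hu : MemH2Per u) (hv : MemH2Per v) :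
    ‖(shiftedLaplace μ u - h.op hε u) - (shiftedLaplace μ v - h.op hε v)‖
      ≤ ε * ‖shiftedLaplace μ u - shiftedLaplace μ v‖ := by
  rw [← shiftedLaplace_sub hu.1 hv.1]
  refine norm_le_of_ae_le_frob (hu.sub hv) hμ hε ?_
  filter_upwards [weakHessian_sub_ae hu.1 hv.1, Lp.coeFn_sub u v, shiftedLaplace_ae μ u,
    shiftedLaplace_ae μ v, h.op_ae hε u, h.op_ae hε v,
    Lp.coeFn_sub (shiftedLaplace μ u - h.op hε u) (shiftedLaplace μ v - h.op hε v),
    Lp.coeFn_sub (shiftedLaplace μ u) (h.op hε u),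
    Lp.coeFn_sub (shiftedLaplace μ v) (h.op hε v)] with y h1 h2 h3 h4 h5 h6 h7 h8 h9
  have := h.near y (weakHessian u y) (weakHessian v y) (u y) (v y)
  rw [h1, h2, h7, Pi.sub_apply, Pi.sub_apply, h8, h9, Pi.sub_apply, Pi.sub_apply, h3, h4, h5, h6,
    abs_sub_comm]
  rw [Matrix.trace_sub] at this
  convert this using 2
  ring

/-- Nearness is applied to the pair `u`, `0`; the term with factor `ε < 1` is absorbed on the left.
-/
theorem norm_shiftedLaplace_le (h : NearLaplace Ψ μ ε) (hμ : 0 < μ) (hε : 0 ≤ ε) (hε1 : ε < 1)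
    {u : L2Cell n} (hu : MemH2Per u) (h0 : h.op hε u = 0) :
    ‖shiftedLaplace μ u‖ ≤ ‖contL2 (fun y => Ψ y 0 0) h.continuous_zero‖ / (1 - ε) := by
  have h1 := h.norm_sub_op_le hμ hε hu memH2Per_zero
  rw [h0, shiftedLaplace_zero, sub_zero, zero_sub, sub_neg_eq_add, op_zero] at h1
  rw [le_div_iff₀ (by linarith)]
  have h2 := norm_sub_le (shiftedLaplace μ u + contL2 (fun y => Ψ y 0 0) h.continuous_zero)
    (contL2 (fun y => Ψ y 0 0) h.continuous_zero)
  rw [add_sub_cancel_right] at h2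
  linarith

theorem existsUnique (h : NearLaplace Ψ μ ε) (hμ : 0 < μ) (hε : 0 ≤ ε) (hε1 : ε < 1) :
    ∃! u : L2Cell n, MemH2Per u ∧ h.op hε u = 0 := by
  choose T hT hLT using exists_shiftedLaplace_eq (n := n) hμ
  -- The unknown is `g = (μ - Δ)u`, so that `T` plays the role of `(μ - Δ)⁻¹` and a fixed point
  -- means `op (T g) = 0`.
  have hcontr : ContractingWith ⟨ε, hε⟩ fun g : L2Cell n => g - h.op hε (T g) := by
    refine ⟨hε1, LipschitzWith.of_dist_le_mul fun g g' => ?_⟩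
    have := h.norm_sub_op_le hμ hε (hT g) (hT g')
    rw [hLT, hLT] at this
    rw [dist_eq_norm, dist_eq_norm]
    exact this
  have hfix := hcontr.fixedPoint_isFixedPt
  refine ⟨T (hcontr.fixedPoint _), ⟨hT _, by simpa [Function.IsFixedPt] using hfix⟩, ?_⟩
  rintro v ⟨hv, hv0⟩
  refine hv.eq_of_shiftedLaplace_eq (hT _) hμ ?_
  rw [hLT]
  have hvT : T (shiftedLaplace μ v) = v := (hT _).eq_of_shiftedLaplace_eq hv hμ (hLT _)
  refine hcontr.fixedPoint_unique ?_
  simp [Function.IsFixedPt, hvT, hv0]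

end NearLaplace

/-! ### Inf-sup inequalities -/

section InfSup

variable {𝒜 ℬ : Type*} [Nonempty ℬ]

theorem bddAbove_range_of_abs_le {ι : Type*} {X : ι → ℝ} {K : ℝ} (hX : ∀ i, |X i| ≤ K) :
    BddAbove (range X) :=
  ⟨K, by rintro _ ⟨i, rfl⟩; exact (abs_le.1 (hX i)).2⟩

theorem bddBelow_range_iSup {X : 𝒜 → ℬ → ℝ} {K : ℝ} (hX : ∀ α β, |X α β| ≤ K) :
    BddBelow (range fun α => ⨆ β, X α β) := by
  refine ⟨-K, ?_⟩
  rintro _ ⟨α, rfl⟩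
  obtain ⟨β⟩ := ‹Nonempty ℬ›
  exact (abs_le.1 (hX α β)).1.trans (le_ciSup (bddAbove_range_of_abs_le (hX α)) β)

variable [Nonempty 𝒜]

theorem iInf_iSup_le_add {X X' : 𝒜 → ℬ → ℝ} {K K' c : ℝ} (hX : ∀ α β, |X α β| ≤ K)
    (hX' : ∀ α β, |X' α β| ≤ K') (h : ∀ α β, X α β ≤ X' α β + c) :
    ⨅ α, ⨆ β, X α β ≤ (⨅ α, ⨆ β, X' α β) + c := by
  rw [← sub_le_iff_le_add]
  refine le_ciInf fun α => ?_
  rw [sub_le_iff_le_add]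
  refine (ciInf_le (bddBelow_range_iSup hX) α).trans (ciSup_le fun β => ?_)
  exact (h α β).trans (by gcongr; exact le_ciSup (bddAbove_range_of_abs_le (hX' α)) β)

/-- Inf-sup is monotone and commutes with adding constants, so a bound uniform in the parameters
survives. The bounds `K`, `K'` exclude the default values of real `⨅` and `⨆`. -/
theorem abs_iInf_iSup_sub_le {X X' : 𝒜 → ℬ → ℝ} {K K' t c : ℝ} (hX : ∀ α β, |X α β| ≤ K)
    (hX' : ∀ α β, |X' α β| ≤ K') (h : ∀ α β, |X α β - X' α β - t| ≤ c) :
    |(⨅ α, ⨆ β, X α β) - (⨅ α, ⨆ β, X' α β) - t| ≤ c := by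
  have h1 := iInf_iSup_le_add (c := t + c) hX hX' fun α β => by linarith [(abs_le.1 (h α β)).2]
  have h2 := iInf_iSup_le_add (c := c - t) hX' hX fun α β => by linarith [(abs_le.1 (h α β)).1]
  exact abs_le.2 ⟨by linarith, by linarith⟩

/-- For `≤`, take `α` whose supremum is below `ε / c`. For `≥`, if `S = sup_β γ X < 0` for some `α`,
then `X ≤ 0` and `c X ≤ γ X ≤ S`, so `sup_β X ≤ S / c < 0`, a contradiction. -/
theorem iInf_iSup_mul_eq_zero {X γ : 𝒜 → ℬ → ℝ} {K c : ℝ} (hX : ∀ α β, |X α β| ≤ K)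
    (hγ : ∀ α β, 0 < γ α β) (hγc : ∀ α β, γ α β ≤ c) (h : ⨅ α, ⨆ β, X α β = 0) :
    ⨅ α, ⨆ β, γ α β * X α β = 0 := by
  have hc : 0 < c := by
    obtain ⟨α⟩ := ‹Nonempty 𝒜›
    obtain ⟨β⟩ := ‹Nonempty ℬ›
    exact (hγ α β).trans_le (hγc α β)
  have hγX : ∀ α β, |γ α β * X α β| ≤ c * K := fun α β => by
    rw [abs_mul, abs_of_pos (hγ α β)]
    exact mul_le_mul (hγc α β) (hX α β) (abs_nonneg _) hc.le
  refine le_antisymm (le_of_forall_pos_le_add fun ε hε => ?_) (le_ciInf fun α => ?_)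
  · obtain ⟨α, hα⟩ := exists_lt_of_ciInf_lt (h.trans_lt (div_pos hε hc))
    refine (ciInf_le (bddBelow_range_iSup hγX) α).trans (ciSup_le fun β => ?_)
    have h1 : X α β ≤ ε / c := (le_ciSup (bddAbove_range_of_abs_le (hX α)) β).trans hα.le
    calc γ α β * X α β ≤ γ α β * (ε / c) := mul_le_mul_of_nonneg_left h1 (hγ α β).le
      _ ≤ c * (ε / c) := mul_le_mul_of_nonneg_right (hγc α β) (by positivity)
      _ = 0 + ε := by field_simp; ring
  · by_contra! hneg
    have h0 : 0 ≤ ⨆ β, X α β := h ▸ ciInf_le (bddBelow_range_iSup hX) α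
    have h1 : ⨆ β, X α β ≤ (⨆ β, γ α β * X α β) / c := ciSup_le fun β => by
      have h2 : γ α β * X α β ≤ ⨆ β, γ α β * X α β :=
        le_ciSup (bddAbove_range_of_abs_le (hγX α)) β
      have h3 : X α β ≤ 0 := by
        by_contra! h4
        linarith [mul_pos (hγ α β) h4]
      rw [le_div_iff₀ hc]
      nlinarith [mul_nonneg (sub_nonneg.2 (hγc α β)) (neg_nonneg.2 h3)]
    exact absurd (h0.trans h1) (not_le.2 (div_neg_of_neg_of_pos hneg hc))

end InfSup

section Compact

variable {𝒜 ℬ : Type*} [TopologicalSpace 𝒜] [TopologicalSpace ℬ] [CompactSpace 𝒜] [CompactSpace ℬ]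

theorem continuous_iInf_iSup {Z : Type*} [TopologicalSpace Z] {X : Z → 𝒜 → ℬ → ℝ}
    (hX : Continuous fun p : Z × 𝒜 × ℬ => X p.1 p.2.1 p.2.2) :
    Continuous fun z => ⨅ α, ⨆ β, X z α β := by
  have h1 : Continuous fun q : Z × 𝒜 => ⨆ β, X q.1 q.2 β := by
    have := (isCompact_univ (X := ℬ)).continuous_sSup (f := fun (q : Z × 𝒜) β => X q.1 q.2 β)
      (hX.comp (f := fun p : (Z × 𝒜) × ℬ => (p.1.1, p.1.2, p.2)) (by fun_prop))
    simp only [image_univ] at this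
    exact this
  have := (isCompact_univ (X := 𝒜)).continuous_sInf (f := fun z α => ⨆ β, X z α β) h1
  simp only [image_univ] at this
  exact this

theorem exists_abs_le_of_continuous {X : 𝒜 → ℬ → ℝ}
    (hX : Continuous fun p : 𝒜 × ℬ => X p.1 p.2) : ∃ K, ∀ α β, |X α β| ≤ K := by
  obtain ⟨K, hK⟩ := (isCompact_univ (X := 𝒜 × ℬ)).exists_bound_of_continuousOn hX.continuousOn
  exact ⟨K, fun α β => hK (α, β) (mem_univ _)⟩

variable [Nonempty 𝒜] [Nonempty ℬ]

/-- The forward direction multiplies by `γ⁻¹`, which is bounded by compactness. -/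
theorem iInf_iSup_mul_eq_zero_iff {X γ : 𝒜 → ℬ → ℝ}
    (hX : Continuous fun p : 𝒜 × ℬ => X p.1 p.2) (hγ : Continuous fun p : 𝒜 × ℬ => γ p.1 p.2)
    (hpos : ∀ α β, 0 < γ α β) :
    ⨅ α, ⨆ β, γ α β * X α β = 0 ↔ ⨅ α, ⨆ β, X α β = 0 := by
  obtain ⟨K, hK⟩ := exists_abs_le_of_continuous hX
  obtain ⟨c, hc⟩ := exists_abs_le_of_continuous hγ
  obtain ⟨K', hK'⟩ := exists_abs_le_of_continuous (X := fun α β => γ α β * X α β) (hγ.mul hX)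
  obtain ⟨c', hc'⟩ := exists_abs_le_of_continuous (X := fun α β => (γ α β)⁻¹)
    (hγ.inv₀ fun p => (hpos p.1 p.2).ne')
  constructor
  · intro h
    have := iInf_iSup_mul_eq_zero hK' (fun α β => inv_pos.2 (hpos α β))
      (fun α β => (le_abs_self _).trans (hc' α β)) h
    simpa only [inv_mul_cancel_left₀ (hpos _ _).ne'] using this
  · exact iInf_iSup_mul_eq_zero hK hpos fun α β => (le_abs_self _).trans (hc α β)

end Compact

/-! ### The Cordes estimate -/

/-- The renormalization factor `(tr A + t) / (|A|² + t²)` of the Cordes condition. -/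
def cordesFactor (A : Matrix (Fin n) (Fin n) ℝ) (t : ℝ) : ℝ := (A.trace + t) / (frob A A + t ^ 2)

theorem frob_smul_left (c : ℝ) (M N : Matrix (Fin n) (Fin n) ℝ) : frob (c • M) N = c * frob M N := by
  simp [frob, Finset.mul_sum, mul_assoc]

theorem frob_sub_left (M M' N : Matrix (Fin n) (Fin n) ℝ) :
    frob (M - M') N = frob M N - frob M' N := by
  simp [frob, sub_mul]

theorem frob_comm (M N : Matrix (Fin n) (Fin n) ℝ) : frob M N = frob N M := by
  simp [frob, mul_comm]

theorem frob_sub_right (M N N' : Matrix (Fin n) (Fin n) ℝ) :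
    frob M (N - N') = frob M N - frob M N' := by
  simp [frob, mul_sub]

theorem frob_one_left (N : Matrix (Fin n) (Fin n) ℝ) : frob 1 N = N.trace := by
  simp [frob, Matrix.one_apply, Matrix.trace]

/-- The Cauchy–Schwarz inequality for the Frobenius product on `ℝⁿˣⁿ × ℝ`. -/
theorem abs_frob_add_mul_le (M N : Matrix (Fin n) (Fin n) ℝ) (r s : ℝ) :
    |frob M N + r * s| ≤ √(frob M M + r ^ 2) * √(frob N N + s ^ 2) := by
  -- `Option` adds to the matrix entries one further coordinate for the scalar.
  have h := Finset.sum_mul_sq_le_sq_mul_sq (Finset.univ : Finset (Option (Fin n × Fin n)))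
    (fun o => o.elim r fun q => M q.1 q.2) (fun o => o.elim s fun q => N q.1 q.2)
  simp only [Fintype.sum_option, Option.elim, Fintype.sum_prod_type] at h
  have hM : 0 ≤ frob M M + r ^ 2 := add_nonneg (frob_self_nonneg M) (sq_nonneg r)
  rw [← Real.sqrt_mul hM]
  refine Real.abs_le_sqrt ?_
  simp only [frob, ← pow_two]
  linarith

/-- The left side is the pairing of `(1 - γA, γt - 1)` with `(N, s)`. As `γ` minimizes the squared
length of the first vector, that length equals `n + 1 - γ (tr A + t)`, and the Cordes condition says
`γ (tr A + t) ≥ n + δ`. -/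
theorem abs_cordes_le {A : Matrix (Fin n) (Fin n) ℝ} {t δ : ℝ} (ht : 0 < t) (hδ : 0 < δ)
    (hA : frob A A + t ^ 2 ≤ 1 / (n + δ) * (A.trace + t) ^ 2)
    (N : Matrix (Fin n) (Fin n) ℝ) (s : ℝ) :
    |cordesFactor A t * (-frob A N + t * s) - (s - N.trace)|
      ≤ √(1 - δ) * √(frob N N + s ^ 2) := by
  set γ := cordesFactor A t with hγ
  have hpos : 0 < frob A A + t ^ 2 := add_pos_of_nonneg_of_pos (frob_self_nonneg A) (by positivity)
  have h1 := abs_frob_add_mul_le (1 - γ • A) N (γ * t - 1) s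
  have h2 : frob (1 - γ • A) N + (γ * t - 1) * s
      = γ * (-frob A N + t * s) - (s - N.trace) := by
    rw [frob_sub_left, frob_smul_left, frob_one_left]
    ring
  rw [h2] at h1
  refine h1.trans (mul_le_mul_of_nonneg_right (Real.sqrt_le_sqrt ?_) (Real.sqrt_nonneg _))
  have h3 : frob (1 - γ • A) (1 - γ • A) = n - 2 * γ * A.trace + γ ^ 2 * frob A A := by
    rw [frob_sub_left, frob_smul_left, frob_sub_right, frob_sub_right, frob_one_left, frob_one_left,
      frob_comm A 1, frob_comm A (γ • A), frob_smul_left, frob_one_left, Matrix.trace_smul,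
      Matrix.trace_one, Fintype.card_fin, smul_eq_mul]
    ring
  have h4 : γ * (frob A A + t ^ 2) = A.trace + t := by
    rw [hγ, cordesFactor, div_mul_cancel₀ _ hpos.ne']
  have hn : 0 < (n : ℝ) + δ := by positivity
  have h5 : n + δ ≤ γ * (A.trace + t) := by
    rw [one_div, inv_mul_eq_div, le_div_iff₀ hn] at hA
    rw [hγ, cordesFactor, div_mul_eq_mul_div, le_div_iff₀ hpos]
    linarith
  rw [h3]
  have h6 : γ ^ 2 * (frob A A + t ^ 2) = γ * (A.trace + t) := by
    rw [pow_two, mul_assoc, h4]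
  linarith

theorem cordesFactor_pos {A : Matrix (Fin n) (Fin n) ℝ} {t : ℝ} (ht : 0 < t) (hA : 0 ≤ A.trace) :
    0 < cordesFactor A t :=
  div_pos (by linarith) (add_pos_of_nonneg_of_pos (frob_self_nonneg A) (by positivity))

section Diffusion

variable {m : ℕ} {𝒜 ℬ : Type*} {G : (Fin n → ℝ) → 𝒜 → ℬ → Matrix (Fin n) (Fin m) ℝ}

theorem trace_diffusion_nonneg (y : Fin n → ℝ) (α : 𝒜) (β : ℬ) :
    0 ≤ (diffusion G y α β).trace := by
  rw [diffusion, Matrix.trace_smul, Matrix.trace]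
  refine smul_nonneg (by norm_num) (Finset.sum_nonneg fun i _ => ?_)
  rw [Matrix.diag_apply, Matrix.mul_apply]
  exact Finset.sum_nonneg fun j _ => mul_self_nonneg _

variable [TopologicalSpace 𝒜] [TopologicalSpace ℬ]

theorem continuous_diffusion (hG : Continuous fun z : (Fin n → ℝ) × 𝒜 × ℬ => G z.1 z.2.1 z.2.2) :
    Continuous fun z : (Fin n → ℝ) × 𝒜 × ℬ => diffusion G z.1 z.2.1 z.2.2 :=
  (hG.matrix_mul hG.matrix_transpose).const_smul (1 / 2 : ℝ)

theorem continuous_frob {Z : Type*} [TopologicalSpace Z] {M N : Z → Matrix (Fin n) (Fin n) ℝ}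
    (hM : Continuous M) (hN : Continuous N) : Continuous fun z => frob (M z) (N z) :=
  continuous_finsetSum _ fun i _ => continuous_finsetSum _ fun j _ =>
    (hM.matrix_elem i j).mul (hN.matrix_elem i j)

theorem continuous_cordesFactor {Z : Type*} [TopologicalSpace Z]
    {M : Z → Matrix (Fin n) (Fin n) ℝ} (hM : Continuous M) {t : ℝ} (ht : 0 < t) :
    Continuous fun z => cordesFactor (M z) t :=
  (hM.matrix_trace.add continuous_const).div ((continuous_frob hM hM).add continuous_const)
    fun z => (add_pos_of_nonneg_of_pos (frob_self_nonneg (M z)) (by positivity)).ne'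

end Diffusion

variable {m : ℕ} {𝒜 ℬ : Type*} [MetricSpace 𝒜] [MetricSpace ℬ]
  {G : (Fin n → ℝ) → 𝒜 → ℬ → Matrix (Fin n) (Fin m) ℝ}
  {b : (Fin n → ℝ) → (Fin n → ℝ) → 𝒜 → ℬ → (Fin n → ℝ)}
  {f : (Fin n → ℝ) → (Fin n → ℝ) → 𝒜 → ℬ → ℝ}

/-! ### The renormalized inf-sup operator -/

/-- The renormalized operator `inf_α sup_β γ {-A : N + σ r - g}`, where `γ` is the Cordes factor. -/
def cordesHamiltonian (G : (Fin n → ℝ) → 𝒜 → ℬ → Matrix (Fin n) (Fin m) ℝ)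
    (g : (Fin n → ℝ) → 𝒜 → ℬ → ℝ) (t σ : ℝ) (y : Fin n → ℝ) (N : Matrix (Fin n) (Fin n) ℝ)
    (r : ℝ) : ℝ :=
  ⨅ α : 𝒜, ⨆ β : ℬ, cordesFactor (diffusion G y α β) t *
    (-frob (diffusion G y α β) N + σ * r - g y α β)

theorem continuous_renormalized {g : (Fin n → ℝ) → 𝒜 → ℬ → ℝ}
    (hG : Continuous fun z : (Fin n → ℝ) × 𝒜 × ℬ => G z.1 z.2.1 z.2.2)
    (hg : Continuous fun z : (Fin n → ℝ) × 𝒜 × ℬ => g z.1 z.2.1 z.2.2) {t : ℝ} (ht : 0 < t)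
    (σ : ℝ) : Continuous fun p : ((Fin n → ℝ) × (Fin n → Fin n → ℝ) × ℝ) × 𝒜 × ℬ =>
      cordesFactor (diffusion G p.1.1 p.2.1 p.2.2) t *
        (-frob (diffusion G p.1.1 p.2.1 p.2.2) (Matrix.of p.1.2.1) + σ * p.1.2.2
          - g p.1.1 p.2.1 p.2.2) := by
  have hq : Continuous fun p : ((Fin n → ℝ) × (Fin n → Fin n → ℝ) × ℝ) × 𝒜 × ℬ =>
      (p.1.1, p.2.1, p.2.2) := by fun_prop
  have hA := (continuous_diffusion hG).comp hq
  have hN : Continuous fun p : ((Fin n → ℝ) × (Fin n → Fin n → ℝ) × ℝ) × 𝒜 × ℬ =>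
      (Matrix.of p.1.2.1 : Matrix (Fin n) (Fin n) ℝ) :=
    continuous_fst.comp (continuous_snd.comp continuous_fst)
  have hr : Continuous fun p : ((Fin n → ℝ) × (Fin n → Fin n → ℝ) × ℝ) × 𝒜 × ℬ =>
      σ * p.1.2.2 := by fun_prop
  exact (continuous_cordesFactor hA ht).mul
    (((continuous_frob hA hN).neg.add hr).sub (hg.comp hq))

theorem CoefficientAssumptions.continuous_cellSource (h : CoefficientAssumptions G b f)
    (x p : Fin n → ℝ) (R : Matrix (Fin n) (Fin n) ℝ) :
    Continuous fun z : (Fin n → ℝ) × 𝒜 × ℬ => cellSource G b f x p R z.1 z.2.1 z.2.2 := by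
  have hx : Continuous fun z : (Fin n → ℝ) × 𝒜 × ℬ => (x, z.1, z.2.1, z.2.2) := by fun_prop
  exact ((continuous_frob (continuous_diffusion h.continuous_G) continuous_const).add
    ((h.continuous_b.comp hx).dotProduct continuous_const)).add (h.continuous_f.comp hx)

variable [CompactSpace 𝒜] [Nonempty 𝒜] [CompactSpace ℬ] [Nonempty ℬ]

theorem nearLaplace_cordesHamiltonian {g : (Fin n → ℝ) → 𝒜 → ℬ → ℝ}
    (hG : Continuous fun z : (Fin n → ℝ) × 𝒜 × ℬ => G z.1 z.2.1 z.2.2)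
    (hg : Continuous fun z : (Fin n → ℝ) × 𝒜 × ℬ => g z.1 z.2.1 z.2.2)
    {lam δ : ℝ} (hlam : 0 < lam) (hδ : 0 < δ)
    (hcordes : ∀ y α β, frob (diffusion G y α β) (diffusion G y α β) + (1 / lam) ^ 2
      ≤ 1 / (n + δ) * ((diffusion G y α β).trace + 1 / lam) ^ 2) (σ : ℝ) :
    NearLaplace (cordesHamiltonian G g (1 / lam) σ) (lam * σ) √(1 - δ) := by
  have ht : 0 < 1 / lam := by positivity
  have hcont := continuous_renormalized hG hg ht σ
  refine ⟨continuous_iInf_iSup hcont, fun y N N' r r' => ?_⟩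
  have hbdd : ∀ (N : Matrix (Fin n) (Fin n) ℝ) (r : ℝ), ∃ K, ∀ α β,
      |cordesFactor (diffusion G y α β) (1 / lam) *
        (-frob (diffusion G y α β) N + σ * r - g y α β)| ≤ K := fun N r =>
    exists_abs_le_of_continuous
      (hcont.comp (f := fun q : 𝒜 × ℬ => ((y, (N : Fin n → Fin n → ℝ), r), q)) (by fun_prop))
  obtain ⟨K, hK⟩ := hbdd N r
  obtain ⟨K', hK'⟩ := hbdd N' r'
  refine abs_iInf_iSup_sub_le hK hK' fun α β => ?_
  -- With `t = 1 / lam` and `s = lam * σ * (r - r')`, the product `t * s` is `σ * (r - r')`; the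
  -- source `g` cancels in the difference.
  have h := abs_cordes_le ht hδ (hcordes y α β) (N - N') (lam * σ * (r - r'))
  convert h using 2
  rw [frob_sub_right]
  field_simp
  ring

theorem cordesHamiltonian_eq_zero_iff {g : (Fin n → ℝ) → 𝒜 → ℬ → ℝ}
    (hG : Continuous fun z : (Fin n → ℝ) × 𝒜 × ℬ => G z.1 z.2.1 z.2.2)
    (hg : Continuous fun z : (Fin n → ℝ) × 𝒜 × ℬ => g z.1 z.2.1 z.2.2) {t : ℝ} (ht : 0 < t)
    (σ : ℝ) (y : Fin n → ℝ) (N : Matrix (Fin n) (Fin n) ℝ) (r : ℝ) :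
    cordesHamiltonian G g t σ y N r = 0 ↔
      ⨅ α : 𝒜, ⨆ β : ℬ, (-frob (diffusion G y α β) N + σ * r - g y α β) = 0 := by
  have hy : Continuous fun q : 𝒜 × ℬ => (y, q.1, q.2) := by fun_prop
  have hA := (continuous_diffusion hG).comp hy
  exact iInf_iSup_mul_eq_zero_iff
    (((continuous_frob hA continuous_const).neg.add continuous_const).sub (hg.comp hy))
    (continuous_cordesFactor hA ht)
    fun α β => cordesFactor_pos ht (trace_diffusion_nonneg y α β)

end PeriodicHJBI

end

/-! ### Conclusion for the cell problem -/

theorem lemma3p2 {n m : ℕ} (hn : 2 ≤ n) {𝒜 ℬ : Type*}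
    [MetricSpace 𝒜] [CompactSpace 𝒜] [Nonempty 𝒜] [MetricSpace ℬ] [CompactSpace ℬ] [Nonempty ℬ]
    (G : (Fin n → ℝ) → 𝒜 → ℬ → Matrix (Fin n) (Fin m) ℝ)
    (b : (Fin n → ℝ) → (Fin n → ℝ) → 𝒜 → ℬ → (Fin n → ℝ))
    (f : (Fin n → ℝ) → (Fin n → ℝ) → 𝒜 → ℬ → ℝ)
    (hcoef : PeriodicHJBI.CoefficientAssumptions G b f)
    (x p : Fin n → ℝ) (R : Matrix (Fin n) (Fin n) ℝ) (hR : R.IsSymm) :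
    (∀ σ : ℝ, 0 < σ →
      ∃! v : PeriodicHJBI.L2Cell n, PeriodicHJBI.IsPeriodicStrongSolution G b f x p R σ v) ∧
    ∃ C : ℝ, 0 < C ∧ ∀ σ : ℝ, 0 < σ → ∀ v : PeriodicHJBI.L2Cell n,
      PeriodicHJBI.IsPeriodicStrongSolution G b f x p R σ v →
        PeriodicHJBI.h2Seminorm v ≤ C := by
  open PeriodicHJBI in
  obtain ⟨lam, δ, hlam, hδ, hδ1, hcordes⟩ := hcoef.cordes
  have ht : 0 < 1 / lam := by positivity
  have hG := hcoef.continuous_G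
  have hg := hcoef.continuous_cellSource x p R
  -- The drift enters only through the source, so its nonnegative term in the Cordes condition can
  -- be dropped.
  have hC : ∀ y α β, frob (diffusion G y α β) (diffusion G y α β) + (1 / lam) ^ 2
      ≤ 1 / (n + δ) * ((diffusion G y α β).trace + 1 / lam) ^ 2 := by
    intro y α β
    have h1 : 0 ≤ (b x y α β ⬝ᵥ b x y α β) / (2 * lam) :=
      div_nonneg (Finset.sum_nonneg fun i _ => mul_self_nonneg _) (by positivity)
    have h2 := hcordes x y α β
    rw [one_div_pow]
    linarith
  have hΨ := nearLaplace_cordesHamiltonian hG hg hlam hδ hC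
  have hε : 0 ≤ √(1 - δ) := Real.sqrt_nonneg _
  have hε1 : √(1 - δ) < 1 := by
    rw [Real.sqrt_lt' one_pos]
    linarith
  have hiff : ∀ (σ : ℝ) (v : L2Cell n), IsPeriodicStrongSolution G b f x p R σ v ↔
      MemH2Per v ∧ (hΨ σ).op hε v = 0 := by
    intro σ v
    rw [(hΨ σ).op_eq_zero_iff]
    simp only [cordesHamiltonian_eq_zero_iff hG hg ht]
    rfl
  -- At `N = 0`, `r = 0` the only occurrence of `σ` is multiplied by zero; this makes `C`
  -- independent of `σ`.
  have hsource : ∀ σ : ℝ, (fun y => cordesHamiltonian G (cellSource G b f x p R) (1 / lam) σ y 0 0)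
      = fun y => cordesHamiltonian G (cellSource G b f x p R) (1 / lam) 0 y 0 0 := by
    intro σ
    simp only [cordesHamiltonian, mul_zero]
  -- The summand `1` makes the constant strictly positive even when the source term vanishes.
  refine ⟨fun σ hσ => ?_, ‖contL2 _ (hΨ 0).continuous_zero‖ / (1 - √(1 - δ)) + 1, ?_,
    fun σ hσ v hv => ?_⟩
  · simp only [hiff]
    exact (hΨ σ).existsUnique (by positivity) hε hε1
  · have : 0 ≤ ‖contL2 _ (hΨ 0).continuous_zero‖ / (1 - √(1 - δ)) :=
      div_nonneg (norm_nonneg _) (by linarith)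
    linarith
  · obtain ⟨hv, hv0⟩ := (hiff σ v).1 hv
    have hμ : 0 < lam * σ := by positivity
    have h1 := (hv.h2Seminorm_le hμ).trans ((hΨ σ).norm_shiftedLaplace_le hμ hε hε1 hv hv0)
    simp only [hsource σ] at h1
    linarith
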